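/- There is a tiling of the Euclidean plane $\mathbb{R}^2$ by pairwise incongruent convex quadrangles that all have the same area and the same perimeter. That is, there are a countable collection $\mathcal{T}$ of compact subsets of $\mathbb{R}^2$ and real numbers $A,p>0$ such that: 1. the interiors of distinct members of $\mathcal{T}$ are disjoint, and the union of all members of $\mathcal{T}$ is $\mathbb{R}^2$; 2. every $T\in\mathcal{T}$ is a (nondegenerate) convex quadrangle, i.e. the convex hull of four points such that, in a suitable cyclic order $v_0,v_1,v_2,v_3$, for each edge $v_iv_{i+1}$ the two other vertices lie strictly on the same side of the line through $v_i$ and $v_{i+1}$; 3. every $T\in\mathcal{T}$ has area $A$ and perimeter $p$, where the perimeter is the sum of the lengths of the four edges; 4. no two distinct members of $\mathcal{T}$ are congruent, i.e. no isometry of the plane (reflections included) maps one onto the other. -/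

import Mathlib

namespace PlaneTiling

/-- The Euclidean plane. -/
abbrev Plane : Type := EuclideanSpace ℝ (Fin 2)

/-- A collection `𝒯` of sets tiles `A`: it is a countable collection of compact sets, distinct tiles
have disjoint interiors, and the union of the tiles is `A`. -/
structure IsTiling (𝒯 : Set (Set Plane)) (A : Set Plane) : Prop where
  countable : 𝒯.Countable
  isCompact : ∀ T ∈ 𝒯, IsCompact T
  packing : 𝒯.Pairwise fun S T => Disjoint (interior S) (interior T)
  covering : ⋃₀ 𝒯 = A

/-- Congruence of subsets of the plane under Euclidean isometries, reflections included. -/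
def SetCongruent (S T : Set Plane) : Prop :=
  ∃ f : Plane ≃ᵢ Plane, f '' S = T

/-- The vertices of `q`, in cyclic order, are those of a nondegenerate convex quadrangle: for each of
the four edges the two remaining vertices lie strictly on the same side of the line through that
edge. In particular the four vertices are distinct and no three of them are collinear. -/
def IsConvexQuadrangle (q : Polygon Plane 4) : Prop :=
  ∀ i : Fin 4, (line[ℝ, q i, q (i + 1)]).SSameSide (q (i + 2)) (q (i + 3))

/-- The closed region bounded by a convex quadrangle. -/
def region (q : Polygon Plane 4) : Set Plane :=
  convexHull ℝ (Set.range q)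

/-- The sum of the lengths of the four edges. -/
noncomputable def perimeter (q : Polygon Plane 4) : ℝ :=
  ∑ i : Fin 4, dist (q i) (q (i + 1))

end PlaneTiling

/-! ### The prescribed areas and perimeters, and their differential at the rhombus. -/

namespace PlaneTiling

open Real Filter Topology

/-! A rhombus of side 3 and height 2√2 can be cut into three convex quadrangles of equal area and
perimeter that share its center: two mirror images with sides 3, 1, √3, √3, and a kite with sides 2,
2, √3, √3. Measuring the second coordinate in units of √2 gives the rhombus integral vertices.

This dissection is deformed. A trapezoid of rescaled area 6 with horizontal bases has a height `H`
and leg slopes `ξ`, `ζ`; four more numbers place the cuts. Two areas (the third follows) and three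
perimeters are prescribed: five equations in seven unknowns. The differential in the last five
unknowns is invertible (`isInvertible_fderiv_dissectionMap`), so `ζ` and the cuts become functions
of `(H, ξ)` near the rhombus (`exists_implicit_dissection`).

In a half-strip of height `H`, trapezoids are glued leg to leg, each `ζ` serving as the next `ξ`. At
the rhombus ∂ζ/∂H = 0 and ∂ζ/∂ξ is about 0.509. Hence the slopes stay near -1/2, and they never
repeat, because the first one is extremal and `ξ ↦ ζ` is injective (`IsFamily.slopes_injective`).
Half-strips of distinct heights fill one side of a line, half-turned ones with further heights the
other side.

For incongruence, distances between vertices identify the role of each vertex, so a cell reveals two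
parameters of its trapezoid, and these determine `(H, ξ)` (`IsFamily.eq_of_congruent`). The
reflection symmetry of the rhombus is the obstacle: it exchanges two cells and fixes the kite. It is
broken by keeping `H` above 2 by several times the deviation `υ` allowed to the slopes
(`exists_isFamily`). -/

/-- The length of the bottom side of the trapezoid of area `6` and height `H` whose left and right
legs are parallel to `(ξ, 1)` and `(ζ, 1)`. -/
noncomputable def bottom (H ξ ζ : ℝ) : ℝ := 6 / H - (ζ - ξ) * H / 2

/-- The Euclidean length of a vector whose second coordinate is rescaled by `√2`. -/
noncomputable def len (x y : ℝ) : ℝ := √(x ^ 2 + 2 * y ^ 2)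

/-- Twice the area of the first cell, the one at the bottom side. -/
noncomputable def areaFst (H ξ ζ y x₀ y₀ : ℝ) : ℝ :=
  bottom H ξ ζ * y + (bottom H ξ ζ + ζ * y) * y₀ - x₀ * y

/-- Twice the area of the third cell, the one at the left leg. -/
noncomputable def areaTrd (H ξ q x₀ y₀ : ℝ) : ℝ :=
  x₀ * H - (ξ * H + q) * y₀ + q * H

noncomputable def perimFst (H ξ ζ y x₀ y₀ : ℝ) : ℝ :=
  bottom H ξ ζ + y * √(2 + ζ ^ 2) + len (bottom H ξ ζ + ζ * y - x₀) (y - y₀) + len x₀ y₀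

noncomputable def perimSnd (H ξ ζ y q x₀ y₀ : ℝ) : ℝ :=
  (H - y) * √(2 + ζ ^ 2) + (bottom H ξ ζ + ζ * H - ξ * H - q)
    + len (bottom H ξ ζ + ζ * y - x₀) (y - y₀) + len (ξ * H + q - x₀) (H - y₀)

noncomputable def perimTrd (H ξ q x₀ y₀ : ℝ) : ℝ :=
  H * √(2 + ξ ^ 2) + q + len (ξ * H + q - x₀) (H - y₀) + len x₀ y₀

/-- The areas and perimeters that have to be prescribed, as functions of the height and the left slope
of the trapezoid (first component) and of the right slope and the cuts (second component). -/
noncomputable def dissectionMap (u : (ℝ × ℝ) × (ℝ × ℝ × ℝ × ℝ × ℝ)) : ℝ × ℝ × ℝ × ℝ × ℝ :=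
  (areaFst u.1.1 u.1.2 u.2.1 u.2.2.1 u.2.2.2.2.1 u.2.2.2.2.2,
   areaTrd u.1.1 u.1.2 u.2.2.2.1 u.2.2.2.2.1 u.2.2.2.2.2,
   perimFst u.1.1 u.1.2 u.2.1 u.2.2.1 u.2.2.2.2.1 u.2.2.2.2.2,
   perimSnd u.1.1 u.1.2 u.2.1 u.2.2.1 u.2.2.2.1 u.2.2.2.2.1 u.2.2.2.2.2,
   perimTrd u.1.1 u.1.2 u.2.2.2.1 u.2.2.2.2.1 u.2.2.2.2.2)

/-- The parameters of the dissected rhombus. -/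
noncomputable def rhombus : (ℝ × ℝ) × (ℝ × ℝ × ℝ × ℝ × ℝ) :=
  ((2, -1 / 2), (-1 / 2, 2 / 3, 1, 1, 1))

theorem contDiffAt_dissectionMap : ContDiffAt ℝ 1 dissectionMap rhombus := by
  unfold dissectionMap areaFst areaTrd perimFst perimSnd perimTrd len bottom
  refine ContDiffAt.prodMk ?_ (ContDiffAt.prodMk ?_ (ContDiffAt.prodMk ?_ (ContDiffAt.prodMk ?_ ?_)))
  all_goals
    fun_prop (disch := norm_num [rhombus])

theorem hasDerivAt_len {f g : ℝ → ℝ} {f' g' a b c : ℝ} (hf : HasDerivAt f f' 0)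
    (hg : HasDerivAt g g' 0) (hf0 : f 0 = a) (hg0 : g 0 = b)
    (h : a ^ 2 + 2 * b ^ 2 = c ^ 2) (hc : 0 < c) :
    HasDerivAt (fun t => len (f t) (g t)) ((a * f' + 2 * b * g') / c) 0 := by
  subst hf0 hg0
  have h1 := ((hf.fun_pow 2).fun_add ((hg.fun_pow 2).const_mul 2)).sqrt (by rw [h]; positivity)
  rw [h, Real.sqrt_sq hc.le] at h1
  refine h1.congr_deriv ?_
  field_simp
  norm_num
  ring

theorem hasDerivAt_sqrt_two_add_sq {f : ℝ → ℝ} {f' : ℝ} (hf : HasDerivAt f f' 0)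
    (hf0 : f 0 = -1 / 2) :
    HasDerivAt (fun t => √(2 + f t ^ 2)) (-f' / 3) 0 := by
  have h9 : 2 + (f 0) ^ 2 = (3 / 2) ^ 2 := by rw [hf0]; norm_num
  have h1 := ((hf.fun_pow 2).const_add 2).sqrt (by rw [h9]; positivity)
  rw [h9, Real.sqrt_sq (by norm_num), hf0] at h1
  refine h1.congr_deriv ?_
  norm_num

theorem hasDerivAt_line (a v : ℝ) : HasDerivAt (fun t : ℝ => a + t * v) v 0 := by
  simpa using ((hasDerivAt_id (0 : ℝ)).mul_const v).const_add a

/-- Along a line through the rhombus everything reduces to one-variable derivatives. There the three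
inner cuts have length √3 and the square roots attached to the legs are 3/2, so all coefficients lie
in ℚ(√3). -/
theorem fderiv_dissectionMap (a b z y q r s : ℝ) :
    fderiv ℝ dissectionMap rhombus ((a, b), (z, y, q, r, s)) =
      (-5 / 2 * a + 5 / 3 * b - z + 3 / 2 * y - 2 / 3 * r + 8 / 3 * s,
       5 / 2 * a - 2 * b + q + 2 * r,
       (-3 / 2 - 5 / 6 * √3) * a + (1 + 5 / 9 * √3) * b + (-11 / 9 - 5 / 27 * √3) * z
         + (3 / 2 - 1 / 2 * √3) * y - 2 / 9 * √3 * r + 8 / 9 * √3 * s,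
       (-1 - 1 / 9 * √3) * b + (5 / 9 - 5 / 27 * √3) * z + (-3 / 2 - 1 / 2 * √3) * y
         + (-1 - 1 / 3 * √3) * q - 2 / 9 * √3 * r - 4 / 9 * √3 * s,
       (3 / 2 + 5 / 6 * √3) * a + (-2 / 3 - 2 / 3 * √3) * b + (1 - 1 / 3 * √3) * q
         + 2 / 3 * √3 * r) := by
  have h3 : √3 ^ 2 = 3 := Real.sq_sqrt (by norm_num)
  have h3' : (0:ℝ) < √3 := by positivity
  have hd : HasFDerivAt dissectionMap (fderiv ℝ dissectionMap rhombus) rhombus :=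
    (contDiffAt_dissectionMap.differentiableAt one_ne_zero).hasFDerivAt
  have hH := hasDerivAt_line 2 a
  have hx := hasDerivAt_line (-1 / 2) b
  have hz := hasDerivAt_line (-1 / 2) z
  have hy := hasDerivAt_line (2 / 3) y
  have hq := hasDerivAt_line 1 q
  have hr := hasDerivAt_line 1 r
  have hs := hasDerivAt_line 1 s
  have hb : HasDerivAt (fun t => bottom (2 + t * a) (-1 / 2 + t * b) (-1 / 2 + t * z))
      (-3 / 2 * a + b - z) 0 := by
    unfold bottom
    have := (((hasDerivAt_const (0:ℝ) (6:ℝ)).fun_div hH (by norm_num)).fun_sub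
      ((((hz.fun_sub hx).fun_mul hH)).div_const 2))
    refine this.congr_deriv ?_
    norm_num
    ring
  have hb0 : bottom (2 + 0 * a) (-1 / 2 + 0 * b) (-1 / 2 + 0 * z) = 3 := by
    unfold bottom; norm_num
  have hPO := hasDerivAt_len (c := √3) (a := 5 / 3) (b := -1 / 3)
    ((hb.fun_add (hz.fun_mul hy)).fun_sub hr) (hy.fun_sub hs)
    (by rw [hb0]; norm_num) (by norm_num) (by rw [h3]; norm_num) h3'
  have hQO := hasDerivAt_len (c := √3) (a := -1) (b := 1)
    (((hx.fun_mul hH).fun_add hq).fun_sub hr) (hH.fun_sub hs)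
    (by norm_num) (by norm_num) (by rw [h3]; norm_num) h3'
  have hO := hasDerivAt_len (c := √3) (a := 1) (b := 1) hr hs
    (by norm_num) (by norm_num) (by rw [h3]; norm_num) h3'
  have hz' := hasDerivAt_sqrt_two_add_sq hz (by norm_num)
  have hx' := hasDerivAt_sqrt_two_add_sq hx (by norm_num)
  have h0 : √(2 + (-1 / 2 + 0 * z) ^ 2) = 3 / 2 := by
    rw [show (2 + (-1 / 2 + 0 * z) ^ 2) = (3 / 2) ^ 2 by ring, Real.sqrt_sq (by norm_num)]
  have h0' : √(2 + (-1 / 2 + 0 * b) ^ 2) = 3 / 2 := by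
    rw [show (2 + (-1 / 2 + 0 * b) ^ 2) = (3 / 2) ^ 2 by ring, Real.sqrt_sq (by norm_num)]
  have e1 := ((hb.fun_mul hy).fun_add ((hb.fun_add (hz.fun_mul hy)).fun_mul hs)).fun_sub
    (hr.fun_mul hy)
  have e2 := ((hr.fun_mul hH).fun_sub (((hx.fun_mul hH).fun_add hq).fun_mul hs)).fun_add
    (hq.fun_mul hH)
  have e3 := ((hb.fun_add (hy.fun_mul hz')).fun_add hPO).fun_add hO
  have e4 := ((((hH.fun_sub hy).fun_mul hz').fun_add (((hb.fun_add (hz.fun_mul hH)).fun_sub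
    (hx.fun_mul hH)).fun_sub hq)).fun_add hPO).fun_add hQO
  have e5 := (((hH.fun_mul hx').fun_add hq).fun_add hQO).fun_add hO
  have e := e1.prodMk (e2.prodMk (e3.prodMk (e4.prodMk e5)))
  have hl : HasDerivAt (fun t : ℝ => (((2 + t * a, -1 / 2 + t * b),
      (-1 / 2 + t * z, 2 / 3 + t * y, 1 + t * q, 1 + t * r, 1 + t * s)) :
      (ℝ × ℝ) × (ℝ × ℝ × ℝ × ℝ × ℝ))) ((a, b), (z, y, q, r, s)) 0 :=
    (hH.prodMk hx).prodMk (hz.prodMk (hy.prodMk (hq.prodMk (hr.prodMk hs))))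
  have hd' : HasFDerivAt dissectionMap (fderiv ℝ dissectionMap rhombus)
      ((2 + (0:ℝ) * a, -1 / 2 + 0 * b),
      (-1 / 2 + 0 * z, 2 / 3 + 0 * y, 1 + 0 * q, 1 + 0 * r, 1 + 0 * s)) := by
    simpa [rhombus] using hd
  have hc := hd'.comp_hasDerivAt (0:ℝ) hl
  rw [hc.unique e, hb0, h0, h0']
  have hi : (√3)⁻¹ = √3 / 3 := by field_simp; rw [h3]
  simp only [div_eq_mul_inv _ √3, hi, Prod.mk.injEq]
  refine ⟨?_, ?_, ?_, ?_, ?_⟩ <;> ring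

end PlaneTiling

/-! ### The kernel of the differential and the implicit function theorem. -/

namespace PlaneTiling

open Real Filter Topology

/-- The derivative at the rhombus of the slope of the right leg with respect to that of the left
leg. -/
noncomputable def contraction : ℝ := (51 - 8 * √3) / 73

/-- The linear system solved for the last five unknowns: the multipliers are the rows of the inverse
matrix over ℚ(√3), and the multiple of `hs` reduces √3². That `z` does not involve `a` keeps the
slopes within `υ` although the height moves by up to `5 * υ`. -/
theorem eq_of_fderiv_dissectionMap_eq_zero {a b z y q r s : ℝ}
    (h : fderiv ℝ dissectionMap rhombus ((a, b), (z, y, q, r, s)) = 0) :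
    z = contraction * b ∧
    y = (-3 - 2 * √3) * a + (752 / 657 + 1192 / 1971 * √3) * b ∧
    q = (9 / 2 + 3 * √3) * a + (-2 - 4 / 3 * √3) * b ∧
    r = (-7 / 2 - 3 / 2 * √3) * a + (2 + 2 / 3 * √3) * b ∧
    s = (7 / 4 + 3 / 4 * √3) * a + (-37 / 73 - 47 / 219 * √3) * b := by
  have hs : √3 ^ 2 = 3 := Real.sq_sqrt (by norm_num)
  rw [fderiv_dissectionMap] at h
  simp only [Prod.mk_eq_zero] at h
  obtain ⟨h1, h2, h3, h4, h5⟩ := h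
  unfold contraction
  refine ⟨?_, ?_, ?_, ?_, ?_⟩
  · linear_combination (18/73 + 33/146 * √3) * h1 + (18/73 + 33/146 * √3) * h2 + (-81/292 +
      -129/292 * √3) * h3 + (117/146 + -57/146 * √3) * h4 + (-81/292 + -129/292 * √3) * h5 - (
      (27/292) * b + (45/292) * z + (243/584) * y + (81/292) * q + (-8/73) * r + (-16/73) * s ) * hs
  · linear_combination (-2/73 + -53/657 * √3) * h1 + (-298/219 + -491/657 * √3) * h2 + (41/146 +
      -191/1314 * √3) * h3 + (17/219 + -227/657 * √3) * h4 + (333/146 + 1561/1314 * √3) * h5 - (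
      (10/9) * a + (-3289/3942) * b + (1075/11826) * z + (215/876) * y + (-41/146) * q + (592/657) *
      r + (16/657) * s ) * hs
  · linear_combination (2 + 1 * √3) * h2 + (-3 + -2 * √3) * h5 - ( (-5/3) * a + (4/3) * b +
      (2/3) * q + (-4/3) * r ) * hs
  · linear_combination (-1/2 + -1/2 * √3) * h2 + (3/2 + 1 * √3) * h5 - ( (5/6) * a + (-2/3) * b
      + (-1/3) * q + (2/3) * r ) * hs
  · linear_combination (141/292 + 19/146 * √3) * h1 + (107/146 + 111/292 * √3) * h2 + (-153/584
      + -49/584 * √3) * h3 + (75/292 + 7/146 * √3) * h4 + (-591/584 + -341/584 * √3) * h5 - (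
      (-5/12) * a + (197/584) * b + (35/5256) * z + (21/1168) * y + (313/1752) * q + (-167/438) * r
      + (-7/73) * s ) * hs

theorem isInvertible_fderiv_dissectionMap :
    (fderiv ℝ dissectionMap rhombus ∘L .inr ℝ (ℝ × ℝ) (ℝ × ℝ × ℝ × ℝ × ℝ)).IsInvertible := by
  set L := fderiv ℝ dissectionMap rhombus ∘L .inr ℝ (ℝ × ℝ) (ℝ × ℝ × ℝ × ℝ × ℝ) with hL
  have hinj : Function.Injective (L : (ℝ × ℝ × ℝ × ℝ × ℝ) →ₗ[ℝ] (ℝ × ℝ × ℝ × ℝ × ℝ)) := by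
    rw [injective_iff_map_eq_zero]
    rintro ⟨z, y, q, r, s⟩ h
    have h' : fderiv ℝ dissectionMap rhombus ((0, 0), (z, y, q, r, s)) = 0 := h
    obtain ⟨h1, h2, h3, h4, h5⟩ := eq_of_fderiv_dissectionMap_eq_zero h'
    simp only [mul_zero, add_zero] at h1 h2 h3 h4 h5
    simp [h1, h2, h3, h4, h5]
  refine ⟨(LinearEquiv.ofInjectiveEndo _ hinj).toContinuousLinearEquiv, ?_⟩
  ext <;> rfl

theorem dissectionMap_rhombus :
    dissectionMap rhombus = (4, 4, 4 + 2 * √3, 4 + 2 * √3, 4 + 2 * √3) := by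
  have h1 : √(2 + (-1 / 2) ^ 2) = 3 / 2 := by
    rw [show (2 + (-1 / 2) ^ 2 : ℝ) = (3 / 2) ^ 2 by norm_num, Real.sqrt_sq (by norm_num)]
  have hb : bottom 2 (-1 / 2) (-1 / 2) = 3 := by norm_num [bottom]
  simp only [dissectionMap, rhombus, areaFst, areaTrd, perimFst, perimSnd, perimTrd, hb, h1, len,
    Prod.mk.injEq]
  norm_num
  ring

/-- The right leg and the cuts of a dissected trapezoid as functions of its height and of the slope
of its left leg, near the rhombus. -/
theorem exists_implicit_dissection :
    ∃ ψ : ℝ × ℝ → ℝ × ℝ × ℝ × ℝ × ℝ, ∃ D : ℝ × ℝ →L[ℝ] ℝ × ℝ × ℝ × ℝ × ℝ,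
      HasStrictFDerivAt ψ D (2, -1 / 2) ∧ ψ (2, -1 / 2) = (-1 / 2, 2 / 3, 1, 1, 1) ∧
      (∀ᶠ x in 𝓝 ((2, -1 / 2) : ℝ × ℝ),
        dissectionMap (x, ψ x) = (4, 4, 4 + 2 * √3, 4 + 2 * √3, 4 + 2 * √3)) ∧
      ∀ a b, (D (a, b)).1 = contraction * b ∧
        (D (a, b)).2.1 = (-3 - 2 * √3) * a + (752 / 657 + 1192 / 1971 * √3) * b ∧
        (D (a, b)).2.2.1 = (9 / 2 + 3 * √3) * a + (-2 - 4 / 3 * √3) * b := by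
  have hd := contDiffAt_dissectionMap.hasStrictFDerivAt one_ne_zero
  have hi := isInvertible_fderiv_dissectionMap
  refine ⟨hd.implicitFunctionOfProdDomain hi, _,
    hd.hasStrictFDerivAt_implicitFunctionOfProdDomain hi, ?_, ?_, ?_⟩
  · exact (hd.eventually_apply_eq_iff_implicitFunctionOfProdDomain hi).self_of_nhds.mp rfl
  · have := hd.eventually_apply_implicitFunctionOfProdDomain hi
    rwa [dissectionMap_rhombus] at this
  · intro a b
    set D := -(fderiv ℝ dissectionMap rhombus ∘L .inr ℝ (ℝ × ℝ) (ℝ × ℝ × ℝ × ℝ × ℝ)).inverse ∘L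
      (fderiv ℝ dissectionMap rhombus ∘L .inl ℝ (ℝ × ℝ) (ℝ × ℝ × ℝ × ℝ × ℝ)) with hD
    -- The graph of `D` lies in the kernel of the differential, so `D` can be read off from the
    -- description of that kernel.
    have h0 : fderiv ℝ dissectionMap rhombus ((a, b), D (a, b)) = 0 := by
      have h1 : (fderiv ℝ dissectionMap rhombus ∘L .inr ℝ (ℝ × ℝ) (ℝ × ℝ × ℝ × ℝ × ℝ)) (D (a, b)) =
          -(fderiv ℝ dissectionMap rhombus ∘L .inl ℝ (ℝ × ℝ) (ℝ × ℝ × ℝ × ℝ × ℝ)) (a, b) := by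
        rw [hD]
        obtain ⟨e, he⟩ := hi
        rw [← he]
        generalize fderiv ℝ dissectionMap rhombus ∘L .inl ℝ (ℝ × ℝ) (ℝ × ℝ × ℝ × ℝ × ℝ) = N
        simp
      rw [← (fderiv ℝ dissectionMap rhombus).comp_inl_add_comp_inr, h1, add_neg_cancel]
    obtain ⟨h1, h2, h3, -, -⟩ := eq_of_fderiv_dissectionMap_eq_zero h0
    exact ⟨h1, h2, h3⟩

end PlaneTiling

/-! ### Shape conditions that persist near the rhombus. -/

namespace PlaneTiling

open Real Filter Topology

/-- Twice the signed area of the triangle `abc`. -/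
def turn (a b c : ℝ × ℝ) : ℝ := (b.1 - a.1) * (c.2 - a.2) - (b.2 - a.2) * (c.1 - a.1)

/-- The squared distance of the points of the plane with rescaled coordinates `a` and `b`. -/
def sqd (a b : ℝ × ℝ) : ℝ := (a.1 - b.1) ^ 2 + 2 * (a.2 - b.2) ^ 2

/-- The points are the vertices of a strictly convex quadrangle, counterclockwise. -/
structure IsCCW (a b c d : ℝ × ℝ) : Prop where
  abc : 0 < turn a b c
  bcd : 0 < turn b c d
  cda : 0 < turn c d a
  dab : 0 < turn d a b

/-- Among the four points, `a, v` are the farthest and `v, p` the closest. -/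
structure IsSpike (a v p o : ℝ × ℝ) : Prop where
  av : 17 / 2 < sqd a v
  vp : sqd v p < 2
  ap : 2 < sqd a p ∧ sqd a p < 17 / 2
  ao : 2 < sqd a o ∧ sqd a o < 17 / 2
  vo : 2 < sqd v o ∧ sqd v o < 17 / 2
  po : 2 < sqd p o ∧ sqd p o < 17 / 2

/-- Four points close to the vertices of a kite with sides `2, 2, √3, √3`, the longer ones
meeting at `v`. -/
structure IsKite (p v q o : ℝ × ℝ) : Prop where
  pq : 10 < sqd p q
  pv : 7 / 2 < sqd p v ∧ sqd p v < 10
  qv : 7 / 2 < sqd q v ∧ sqd q v < 10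
  po : 2 < sqd p o ∧ sqd p o < 7 / 2
  qo : 2 < sqd q o ∧ sqd q o < 7 / 2
  vo : 2 < sqd v o ∧ sqd v o < 10

/-- The parameters of a dissected trapezoid: its height `H`, the slopes `ξ` and `ζ` of its legs, and
the position of the cuts. -/
structure Dissection where
  H : ℝ
  ξ : ℝ
  ζ : ℝ
  y : ℝ
  q : ℝ
  x₀ : ℝ
  y₀ : ℝ

namespace Dissection

variable (d : Dissection)

noncomputable def b : ℝ := bottom d.H d.ξ d.ζ

def v₁ : ℝ × ℝ := (0, 0)
noncomputable def v₂ : ℝ × ℝ := (d.b, 0)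
noncomputable def v₃ : ℝ × ℝ := (d.b + d.ζ * d.H, d.H)
noncomputable def v₄ : ℝ × ℝ := (d.ξ * d.H, d.H)
noncomputable def p : ℝ × ℝ := (d.b + d.ζ * d.y, d.y)
noncomputable def r : ℝ × ℝ := (d.ξ * d.H + d.q, d.H)
noncomputable def o : ℝ × ℝ := (d.x₀, d.y₀)

structure IsGood : Prop where
  H_pos : 0 < d.H
  b_pos : 0 < d.b
  y_pos : 0 < d.y
  y_lt : d.y < d.H
  q_pos : 0 < d.q
  q_lt : d.q < d.b + d.ζ * d.H - d.ξ * d.H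
  fst : IsCCW v₁ d.v₂ d.p d.o
  snd : IsCCW d.p d.v₃ d.r d.o
  trd : IsCCW v₁ d.o d.r d.v₄
  spike : IsSpike v₁ d.v₂ d.p d.o
  kite : IsKite d.p d.v₃ d.r d.o
  spike' : IsSpike v₁ d.v₄ d.r d.o

structure IsBalanced : Prop where
  areaFst : areaFst d.H d.ξ d.ζ d.y d.x₀ d.y₀ = 4
  areaTrd : areaTrd d.H d.ξ d.q d.x₀ d.y₀ = 4
  perimFst : perimFst d.H d.ξ d.ζ d.y d.x₀ d.y₀ = 4 + 2 * √3
  perimSnd : perimSnd d.H d.ξ d.ζ d.y d.q d.x₀ d.y₀ = 4 + 2 * √3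
  perimTrd : perimTrd d.H d.ξ d.q d.x₀ d.y₀ = 4 + 2 * √3

/-- The dissection with the given parameters. -/
def ofTuple (u : (ℝ × ℝ) × (ℝ × ℝ × ℝ × ℝ × ℝ)) : Dissection :=
  ⟨u.1.1, u.1.2, u.2.1, u.2.2.1, u.2.2.2.1, u.2.2.2.2.1, u.2.2.2.2.2⟩

end Dissection

open Dissection

theorem eventually_isGood : ∀ᶠ u in 𝓝 rhombus, (ofTuple u).IsGood := by
  have hb : ContinuousAt (fun u => (ofTuple u).b) rhombus := by
    unfold Dissection.b bottom ofTuple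
    fun_prop (disch := norm_num [rhombus])
  have hb0 : (ofTuple rhombus).b = 3 := by
    simp only [Dissection.b, bottom, ofTuple, rhombus]; norm_num
  have hH : Continuous (fun u => (ofTuple u).H) := by unfold ofTuple; fun_prop
  have hξ : Continuous (fun u => (ofTuple u).ξ) := by unfold ofTuple; fun_prop
  have hζ : Continuous (fun u => (ofTuple u).ζ) := by unfold ofTuple; fun_prop
  have hy : Continuous (fun u => (ofTuple u).y) := by unfold ofTuple; fun_prop
  have hq : Continuous (fun u => (ofTuple u).q) := by unfold ofTuple; fun_prop
  have hx₀ : Continuous (fun u => (ofTuple u).x₀) := by unfold ofTuple; fun_prop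
  have hy₀ : Continuous (fun u => (ofTuple u).y₀) := by unfold ofTuple; fun_prop
  have cv2 : ContinuousAt (fun u => (ofTuple u).v₂) rhombus := by
    unfold Dissection.v₂; fun_prop
  have cv3 : ContinuousAt (fun u => (ofTuple u).v₃) rhombus := by
    unfold Dissection.v₃; fun_prop
  have cv4 : ContinuousAt (fun u => (ofTuple u).v₄) rhombus := by
    unfold Dissection.v₄; fun_prop
  have cp : ContinuousAt (fun u => (ofTuple u).p) rhombus := by
    unfold Dissection.p; fun_prop
  have cr : ContinuousAt (fun u => (ofTuple u).r) rhombus := by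
    unfold Dissection.r; fun_prop
  have co : ContinuousAt (fun u => (ofTuple u).o) rhombus := by
    unfold Dissection.o; fun_prop
  have cv1 : ContinuousAt (fun u : (ℝ × ℝ) × (ℝ × ℝ × ℝ × ℝ × ℝ) => v₁) rhombus :=
    continuousAt_const
  have ev2 : (ofTuple rhombus).v₂ = (3, 0) := by simp [Dissection.v₂, hb0]
  have ev3 : (ofTuple rhombus).v₃ = (2, 2) := by
    rw [Dissection.v₃, hb0]; norm_num [ofTuple, rhombus]
  have ev4 : (ofTuple rhombus).v₄ = (-1, 2) := by
    simp only [Dissection.v₄, ofTuple, rhombus]; norm_num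
  have ep : (ofTuple rhombus).p = (8 / 3, 2 / 3) := by
    rw [Dissection.p, hb0]; norm_num [ofTuple, rhombus]
  have er : (ofTuple rhombus).r = (0, 2) := by
    simp only [Dissection.r, ofTuple, rhombus]; norm_num
  have eo : (ofTuple rhombus).o = (1, 1) := by
    simp only [Dissection.o, ofTuple, rhombus]
  have ct : ∀ {f g h : (ℝ × ℝ) × (ℝ × ℝ × ℝ × ℝ × ℝ) → ℝ × ℝ}, ContinuousAt f rhombus →
      ContinuousAt g rhombus → ContinuousAt h rhombus →
      0 < turn (f rhombus) (g rhombus) (h rhombus) →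
      ∀ᶠ u in 𝓝 rhombus, 0 < turn (f u) (g u) (h u) := by
    intro f g h hf hg hh h0
    refine ContinuousAt.eventually_lt continuousAt_const ?_ h0
    unfold turn
    fun_prop
  have cs : ∀ {f g : (ℝ × ℝ) × (ℝ × ℝ × ℝ × ℝ × ℝ) → ℝ × ℝ} (a : ℝ), ContinuousAt f rhombus →
      ContinuousAt g rhombus → a < sqd (f rhombus) (g rhombus) →
      ∀ᶠ u in 𝓝 rhombus, a < sqd (f u) (g u) := by
    intro f g a hf hg h0
    refine ContinuousAt.eventually_lt continuousAt_const ?_ h0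
    unfold sqd
    fun_prop
  have cs' : ∀ {f g : (ℝ × ℝ) × (ℝ × ℝ × ℝ × ℝ × ℝ) → ℝ × ℝ} (a : ℝ), ContinuousAt f rhombus →
      ContinuousAt g rhombus → sqd (f rhombus) (g rhombus) < a →
      ∀ᶠ u in 𝓝 rhombus, sqd (f u) (g u) < a := by
    intro f g a hf hg h0
    refine ContinuousAt.eventually_lt ?_ continuousAt_const h0
    unfold sqd
    fun_prop
  have ccw : ∀ {f g h k : (ℝ × ℝ) × (ℝ × ℝ × ℝ × ℝ × ℝ) → ℝ × ℝ}, ContinuousAt f rhombus →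
      ContinuousAt g rhombus → ContinuousAt h rhombus → ContinuousAt k rhombus →
      IsCCW (f rhombus) (g rhombus) (h rhombus) (k rhombus) →
      ∀ᶠ u in 𝓝 rhombus, IsCCW (f u) (g u) (h u) (k u) := by
    intro f g h k hf hg hh hk h0
    filter_upwards [ct hf hg hh h0.abc, ct hg hh hk h0.bcd, ct hh hk hf h0.cda, ct hk hf hg h0.dab]
      with u h1 h2 h3 h4 using ⟨h1, h2, h3, h4⟩
  have spk : ∀ {f g h k : (ℝ × ℝ) × (ℝ × ℝ × ℝ × ℝ × ℝ) → ℝ × ℝ}, ContinuousAt f rhombus →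
      ContinuousAt g rhombus → ContinuousAt h rhombus → ContinuousAt k rhombus →
      IsSpike (f rhombus) (g rhombus) (h rhombus) (k rhombus) →
      ∀ᶠ u in 𝓝 rhombus, IsSpike (f u) (g u) (h u) (k u) := by
    intro f g h k hf hg hh hk h0
    filter_upwards [cs _ hf hg h0.av, cs' _ hg hh h0.vp, cs _ hf hh h0.ap.1, cs' _ hf hh h0.ap.2,
      cs _ hf hk h0.ao.1, cs' _ hf hk h0.ao.2, cs _ hg hk h0.vo.1, cs' _ hg hk h0.vo.2,
      cs _ hh hk h0.po.1, cs' _ hh hk h0.po.2]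
      with u h1 h2 h3 h4 h5 h6 h7 h8 h9 h10
    exact ⟨h1, h2, ⟨h3, h4⟩, ⟨h5, h6⟩, ⟨h7, h8⟩, ⟨h9, h10⟩⟩
  have kit : ∀ᶠ u in 𝓝 rhombus, IsKite (ofTuple u).p (ofTuple u).v₃ (ofTuple u).r (ofTuple u).o := by
    filter_upwards [cs 10 cp cr (by rw [ep, er]; norm_num [sqd]),
      cs (7 / 2) cp cv3 (by rw [ep, ev3]; norm_num [sqd]),
      cs' 10 cp cv3 (by rw [ep, ev3]; norm_num [sqd]),
      cs (7 / 2) cr cv3 (by rw [er, ev3]; norm_num [sqd]),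
      cs' 10 cr cv3 (by rw [er, ev3]; norm_num [sqd]),
      cs 2 cp co (by rw [ep, eo]; norm_num [sqd]),
      cs' (7 / 2) cp co (by rw [ep, eo]; norm_num [sqd]),
      cs 2 cr co (by rw [er, eo]; norm_num [sqd]),
      cs' (7 / 2) cr co (by rw [er, eo]; norm_num [sqd]),
      cs 2 cv3 co (by rw [ev3, eo]; norm_num [sqd]),
      cs' 10 cv3 co (by rw [ev3, eo]; norm_num [sqd])]
      with u h1 h2 h3 h4 h5 h6 h7 h8 h9 h10 h11
    exact ⟨h1, ⟨h2, h3⟩, ⟨h4, h5⟩, ⟨h6, h7⟩, ⟨h8, h9⟩, ⟨h10, h11⟩⟩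
  have z : ContinuousAt (fun _ : (ℝ × ℝ) × (ℝ × ℝ × ℝ × ℝ × ℝ) => (0 : ℝ)) rhombus :=
    continuousAt_const
  filter_upwards [z.eventually_lt hH.continuousAt (by norm_num [ofTuple, rhombus]),
    z.eventually_lt hb (by rw [hb0]; norm_num),
    z.eventually_lt hy.continuousAt (by norm_num [ofTuple, rhombus]),
    hy.continuousAt.eventually_lt hH.continuousAt (by norm_num [ofTuple, rhombus]),
    z.eventually_lt hq.continuousAt (by norm_num [ofTuple, rhombus]),
    hq.continuousAt.eventually_lt
      (show ContinuousAt (fun u => (ofTuple u).b + (ofTuple u).ζ * (ofTuple u).H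
        - (ofTuple u).ξ * (ofTuple u).H) rhombus by fun_prop)
      (by rw [hb0]; norm_num [ofTuple, rhombus]),
    ccw cv1 cv2 cp co (by rw [ev2, ep, eo]; constructor <;> norm_num [turn, v₁]),
    ccw cp cv3 cr co (by rw [ev3, ep, er, eo]; constructor <;> norm_num [turn, v₁]),
    ccw cv1 co cr cv4 (by rw [ev4, er, eo]; constructor <;> norm_num [turn, v₁]),
    spk cv1 cv2 cp co (by rw [ev2, ep, eo]; constructor <;> norm_num [sqd, v₁]),
    kit,
    spk cv1 cv4 cr co (by rw [ev4, er, eo]; constructor <;> norm_num [sqd, v₁])]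
    with u h1 h2 h3 h4 h5 h6 h7 h8 h9 h10 h11 h12
  exact ⟨h1, h2, h3, h4, h5, h6, h7, h8, h9, h10, h11, h12⟩

end PlaneTiling

/-! ### Quantitative control of the implicit functions. -/

namespace PlaneTiling

open Real Filter Topology Dissection

/-- The height and the left slope are in the range that is used for the tiling of size `υ`. -/
structure InRange (υ H ξ : ℝ) : Prop where
  H_lower : 2 + 4 * υ ≤ H
  H_upper : H ≤ 2 + 5 * υ
  ξ_abs : |ξ + 1 / 2| ≤ υ

theorem exists_strict_bounds :
    ∃ ψ : ℝ × ℝ → ℝ × ℝ × ℝ × ℝ × ℝ, ∃ δ > 0,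
      ψ (2, -1 / 2) = (-1 / 2, 2 / 3, 1, 1, 1) ∧
      (∀ H ξ : ℝ, |H - 2| < δ → |ξ + 1 / 2| < δ →
        (ofTuple ((H, ξ), ψ (H, ξ))).IsGood ∧ (ofTuple ((H, ξ), ψ (H, ξ))).IsBalanced) ∧
      ∀ H ξ H' ξ' : ℝ, |H - 2| < δ → |ξ + 1 / 2| < δ → |H' - 2| < δ → |ξ' + 1 / 2| < δ →
        |(ψ (H, ξ)).1 - (ψ (H', ξ')).1 - contraction * (ξ - ξ')|
          ≤ 1 / 100 * (|H - H'| + |ξ - ξ'|) ∧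
        |(ψ (H, ξ)).2.1 - (ψ (H', ξ')).2.1 - ((-3 - 2 * √3) * (H - H')
          + (752 / 657 + 1192 / 1971 * √3) * (ξ - ξ'))| ≤ 1 / 100 * (|H - H'| + |ξ - ξ'|) ∧
        |(ψ (H, ξ)).2.2.1 - (ψ (H', ξ')).2.2.1 - ((9 / 2 + 3 * √3) * (H - H')
          + (-2 - 4 / 3 * √3) * (ξ - ξ'))| ≤ 1 / 100 * (|H - H'| + |ξ - ξ'|) := by
  obtain ⟨ψ, D, hψ, hψ0, heq, hD⟩ := exists_implicit_dissection
  have hgood : ∀ᶠ x in 𝓝 ((2, -1 / 2) : ℝ × ℝ), (ofTuple (x, ψ x)).IsGood := by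
    have hc : Tendsto (fun x => (x, ψ x)) (𝓝 ((2, -1 / 2) : ℝ × ℝ)) (𝓝 rhombus) := by
      have : rhombus = ((2, -1 / 2), ψ (2, -1 / 2)) := by rw [hψ0]; rfl
      rw [this]
      exact (continuousAt_id.prodMk hψ.continuousAt)
    exact hc.eventually eventually_isGood
  -- Strict differentiability compares any two nearby points, not just a point with the base point;
  -- the injectivity statements need this.
  have hs := hψ.isLittleO.def (show (0 : ℝ) < 1 / 100 by norm_num)
  obtain ⟨δ₁, hδ₁, h₁⟩ := Metric.eventually_nhds_iff.1 (hgood.and heq)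
  obtain ⟨δ₂, hδ₂, h₂⟩ := Metric.eventually_nhds_iff.1 hs
  refine ⟨ψ, min δ₁ δ₂, lt_min hδ₁ hδ₂, hψ0, ?_, ?_⟩
  · intro H ξ hH hξ
    have : dist ((H, ξ) : ℝ × ℝ) (2, -1 / 2) < δ₁ := by
      rw [Prod.dist_eq, Real.dist_eq, Real.dist_eq]
      refine max_lt (hH.trans_le (min_le_left _ _)) ?_
      rw [show ξ - -1 / 2 = ξ + 1 / 2 by ring]
      exact hξ.trans_le (min_le_left _ _)
    obtain ⟨hg, he⟩ := h₁ this
    refine ⟨hg, ?_⟩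
    simp only [dissectionMap, Prod.mk.injEq] at he
    exact ⟨he.1, he.2.1, he.2.2.1, he.2.2.2.1, he.2.2.2.2⟩
  · intro H ξ H' ξ' hH hξ hH' hξ'
    have hd : dist (((H, ξ), (H', ξ')) : (ℝ × ℝ) × (ℝ × ℝ)) ((2, -1 / 2), (2, -1 / 2)) < δ₂ := by
      rw [Prod.dist_eq, Prod.dist_eq, Prod.dist_eq]
      simp only [Real.dist_eq]
      rw [show ξ - -1 / 2 = ξ + 1 / 2 by ring, show ξ' - -1 / 2 = ξ' + 1 / 2 by ring]
      have := min_le_right δ₁ δ₂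
      refine max_lt (max_lt ?_ ?_) (max_lt ?_ ?_) <;> linarith
    have h := h₂ hd
    have hle : ‖((H, ξ) - (H', ξ') : ℝ × ℝ)‖ ≤ |H - H'| + |ξ - ξ'| := by
      rw [Prod.norm_def]
      simp only [Prod.fst_sub, Prod.snd_sub, Real.norm_eq_abs]
      exact max_le (by linarith [abs_nonneg (ξ - ξ')]) (by linarith [abs_nonneg (H - H')])
    have hw_le := h.trans (mul_le_mul_of_nonneg_left hle (by norm_num))
    obtain ⟨e1, e2, e3⟩ := hD (H - H') (ξ - ξ')
    dsimp only at hw_le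
    set w := ψ (H, ξ) - ψ (H', ξ') - D ((H, ξ) - (H', ξ')) with hw
    have hw' : w = ψ (H, ξ) - ψ (H', ξ') - D (H - H', ξ - ξ') := rfl
    refine ⟨?_, ?_, ?_⟩
    · rw [← e1]
      have : ‖w.1‖ ≤ ‖w‖ := norm_fst_le w
      rw [Real.norm_eq_abs, hw'] at this
      exact this.trans hw_le
    · rw [← e2]
      have : ‖w.2.1‖ ≤ ‖w‖ := (norm_fst_le w.2).trans (norm_snd_le w)
      rw [Real.norm_eq_abs, hw'] at this
      exact this.trans hw_le
    · rw [← e3]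
      have : ‖w.2.2.1‖ ≤ ‖w‖ := ((norm_fst_le w.2.2).trans (norm_snd_le w.2)).trans (norm_snd_le w)
      rw [Real.norm_eq_abs, hw'] at this
      exact this.trans hw_le

/-- A family of balanced dissections, parametrized by the height and the slope of the left leg, in
which the shape of each cell determines these parameters. -/
structure IsFamily (υ : ℝ) (d : ℝ → ℝ → Dissection) : Prop where
  H_eq : ∀ H ξ, (d H ξ).H = H
  ξ_eq : ∀ H ξ, (d H ξ).ξ = ξ
  isGood : ∀ H ξ, InRange υ H ξ → (d H ξ).IsGood
  isBalanced : ∀ H ξ, InRange υ H ξ → (d H ξ).IsBalanced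
  abs_ζ_lt : ∀ H ξ, InRange υ H ξ → |(d H ξ).ζ + 1 / 2| < υ
  side_lt : ∀ H ξ, InRange υ H ξ →
    (d H ξ).b + (d H ξ).ζ * H - ξ * H - (d H ξ).q < (H - (d H ξ).y) * √(2 + (d H ξ).ζ ^ 2)
  eq_of_ζ_eq : ∀ H ξ ξ', InRange υ H ξ → InRange υ H ξ' → (d H ξ).ζ = (d H ξ').ζ → ξ = ξ'
  eq_of_b_eq : ∀ H ξ H' ξ', InRange υ H ξ → InRange υ H' ξ' → (d H ξ).ζ = (d H' ξ').ζ →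
    (d H ξ).b = (d H' ξ').b → H = H' ∧ ξ = ξ'
  eq_of_y_eq : ∀ H ξ H' ξ', InRange υ H ξ → InRange υ H' ξ' → (d H ξ).ζ = (d H' ξ').ζ →
    H - (d H ξ).y = H' - (d H' ξ').y → H = H' ∧ ξ = ξ'
  b_lt : ∀ H ξ H' ξ', InRange υ H ξ → InRange υ H' ξ' → (d H ξ).b < H' * √(2 + (d H ξ).ζ ^ 2)

-- Every claim compares linear terms with an error of at most 1/100 of the displacement. The heights
-- exceed 2 by at least `4 * υ` while the slopes deviate by at most `υ`, so the effect of the height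
-- fixes the sign of each difference that vanishes at the rhombus.
set_option maxHeartbeats 800000 in
theorem exists_isFamily : ∃ υ > 0, υ ≤ 1 / 100 ∧ ∃ d, IsFamily υ d := by
  obtain ⟨ψ, δ, hδ, hψ0, hgood, hstrict⟩ := exists_strict_bounds
  have hr1 : (1.732 : ℝ) < √3 := Real.lt_sqrt_of_sq_lt (by norm_num)
  have hr2 : √3 < 1.7321 := (Real.sqrt_lt' (by norm_num)).2 (by norm_num)
  have hc1 : 0.508 < contraction := by unfold contraction; linarith
  have hc2 : contraction < 0.51 := by unfold contraction; linarith
  set μ := 752 / 657 + 1192 / 1971 * √3 with hμ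
  have hμ1 : 2 < μ := by rw [hμ]; linarith
  have hμ2 : μ < 2.2 := by rw [hμ]; linarith
  set υ := min (δ / 6) (1 / 100) with hυ
  have hυ0 : 0 < υ := lt_min (by positivity) (by norm_num)
  have hυδ : 5 * υ < δ := by have := min_le_left (δ / 6) (1 / 100); linarith
  have hυ1 : υ ≤ 1 / 100 := min_le_right _ _
  have hnear : ∀ H ξ, InRange υ H ξ → |H - 2| < δ ∧ |ξ + 1 / 2| < δ := by
    intro H ξ h
    refine ⟨abs_lt.2 ⟨?_, ?_⟩, ?_⟩
    · linarith [h.H_lower]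
    · linarith [h.H_upper]
    · linarith [h.ξ_abs]
  -- Comparison with the rhombus, with error at most 0.06υ. The constants leave room: 0.51 + 0.06 <
  -- 3/5, then 24 - 2.2 - 0.06 > 20, and 36 - 5 - 0.06 > 30.
  have hbase : ∀ H ξ, InRange υ H ξ → |(ψ (H, ξ)).1 + 1 / 2| ≤ 3 / 5 * υ ∧
      (ψ (H, ξ)).2.1 ≤ 2 / 3 - 20 * υ ∧ 1 + 30 * υ ≤ (ψ (H, ξ)).2.2.1 := by
    intro H ξ h
    obtain ⟨h1, h2⟩ := hnear H ξ h
    obtain ⟨a1, a2, a3⟩ := hstrict H ξ 2 (-1 / 2) h1 h2 (by simpa using hδ) (by norm_num; exact hδ)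
    rw [show ξ - -1 / 2 = ξ + 1 / 2 by ring, hψ0] at a1 a2 a3
    simp only at a1 a2 a3
    have hH : |H - 2| ≤ 5 * υ := abs_le.2 ⟨by linarith [h.H_lower], by linarith [h.H_upper]⟩
    have hsm : 1 / 100 * (|H - 2| + |ξ + 1 / 2|) ≤ 6 / 100 * υ := by linarith [h.ξ_abs]
    have hξ := abs_le.1 h.ξ_abs
    have b1 := abs_le.1 (a1.trans hsm)
    have b2 := abs_le.1 (a2.trans hsm)
    have b3 := abs_le.1 (a3.trans hsm)
    have hHl : 4 * υ ≤ H - 2 := by linarith [h.H_lower]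
    have p1 := abs_le.1 ((abs_mul contraction (ξ + 1 / 2)).le.trans
      (mul_le_mul ((abs_of_pos (by linarith)).le.trans hc2.le) h.ξ_abs (abs_nonneg _) (by norm_num)))
    have p2 := abs_le.1 ((abs_mul μ (ξ + 1 / 2)).le.trans
      (mul_le_mul ((abs_of_pos (by linarith)).le.trans hμ2.le) h.ξ_abs (abs_nonneg _) (by norm_num)))
    have p3 : 4 * υ * 6 ≤ (H - 2) * (3 + 2 * √3) :=
      mul_le_mul hHl (by linarith) (by norm_num) (by linarith)
    have p4 : 4 * υ * 9 ≤ (H - 2) * (9 / 2 + 3 * √3) :=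
      mul_le_mul hHl (by linarith) (by norm_num) (by linarith)
    have p5 : (2 + 4 / 3 * √3) * (ξ + 1 / 2) ≤ 5 * υ :=
      (mul_le_mul_of_nonneg_left hξ.2 (by linarith)).trans
        (mul_le_mul_of_nonneg_right (by linarith) hυ0.le)
    refine ⟨abs_le.2 ⟨?_, ?_⟩, ?_, ?_⟩ <;> linarith
  have hsq : ∀ ζ, |ζ + 1 / 2| ≤ υ → 3 / 2 - υ ≤ √(2 + ζ ^ 2) := by
    intro ζ h
    have := abs_le.1 h
    refine Real.le_sqrt_of_sq_le ?_
    nlinarith only [this.1, this.2, hυ0, hυ1]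
  -- As `ζ` depends on `H` only through the error term, equal `ζ` make the change of `ξ` negligible
  -- against that of `H`. The three uniqueness claims below rest on this.
  have hξζ : ∀ H ξ H' ξ', InRange υ H ξ → InRange υ H' ξ' → (ψ (H, ξ)).1 = (ψ (H', ξ')).1 →
      |ξ - ξ'| ≤ 1 / 40 * |H - H'| := by
    intro H ξ H' ξ' h h' he
    obtain ⟨h1, h2⟩ := hnear H ξ h
    obtain ⟨h1', h2'⟩ := hnear H' ξ' h'
    have a1 := (hstrict H ξ H' ξ' h1 h2 h1' h2').1
    rw [he, sub_self, zero_sub, abs_neg, abs_mul, abs_of_pos (by linarith)] at a1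
    linarith [abs_nonneg (ξ - ξ'), abs_nonneg (H - H'),
      mul_le_mul_of_nonneg_right hc1.le (abs_nonneg (ξ - ξ'))]
  refine ⟨υ, hυ0, hυ1, fun H ξ => ofTuple ((H, ξ), ψ (H, ξ)), fun H ξ => rfl, fun H ξ => rfl,
    fun H ξ h => (hgood H ξ (hnear H ξ h).1 (hnear H ξ h).2).1,
    fun H ξ h => (hgood H ξ (hnear H ξ h).1 (hnear H ξ h).2).2, ?_, ?_, ?_, ?_, ?_, ?_⟩
  · intro H ξ h
    show |(ψ (H, ξ)).1 + 1 / 2| < υ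
    linarith [(hbase H ξ h).1]
  · intro H ξ h
    obtain ⟨c1, c2, c3⟩ := hbase H ξ h
    show bottom H ξ (ψ (H, ξ)).1 + (ψ (H, ξ)).1 * H - ξ * H - (ψ (H, ξ)).2.2.1 <
      (H - (ψ (H, ξ)).2.1) * √(2 + (ψ (H, ξ)).1 ^ 2)
    have hs := hsq (ψ (H, ξ)).1 (by linarith)
    set ζ := (ψ (H, ξ)).1
    have hH := h.H_lower
    have hH' := h.H_upper
    have h6 : 6 / H ≤ 3 := by rw [div_le_iff₀ (by linarith)]; linarith
    have hζ := abs_le.1 c1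
    have hξ := abs_le.1 h.ξ_abs
    -- Both outer sides of the kite are 2 at the rhombus. This one does not drop below 2, while the
    -- other is at most 3 + 4υ - (1 + 30υ).
    have hl : 2 ≤ (H - (ψ (H, ξ)).2.1) * √(2 + ζ ^ 2) := by
      calc (2 : ℝ) ≤ (4 / 3 + 24 * υ) * (3 / 2 - υ) := by nlinarith only [hυ0, hυ1]
        _ ≤ _ := mul_le_mul (by linarith) hs (by linarith) (by linarith)
    have hm : (ζ - ξ) * H / 2 ≤ 4 * υ := by
      nlinarith only [hζ.2, hξ.1, hH, hH', hυ0, hυ1]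
    unfold bottom
    linarith
  · intro H ξ ξ' h h' he
    have := hξζ H ξ H ξ' h h' he
    rw [sub_self, abs_zero, mul_zero] at this
    linarith [abs_eq_zero.1 (le_antisymm this (abs_nonneg _))]
  · intro H ξ H' ξ' h h' he hb
    have hx := hξζ H ξ H' ξ' h h' he
    have hζ := abs_le.1 (hbase H ξ h).1
    have hξ := abs_le.1 h.ξ_abs
    change bottom H ξ (ψ (H, ξ)).1 = bottom H' ξ' (ψ (H', ξ')).1 at hb
    rw [← show (ψ (H, ξ)).1 = (ψ (H', ξ')).1 from he] at hb
    set ζ := (ψ (H, ξ)).1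
    have hH := h.H_lower
    have hHu := h.H_upper
    have hH' := h'.H_lower
    have hHu' := h'.H_upper
    have hp : 0 < H * H' := mul_pos (by linarith) (by linarith)
    have h5 : H * H' ≤ 5 := by nlinarith only [hH, hHu, hH', hHu', hυ0, hυ1]
    -- Equality of the bases, arranged so that the coefficient on the left is at least 6/5 while the
    -- right side is at most a tenth of `|H - H'|`.
    have e1 : 6 / (H * H') * (H - H') = -((ζ - ξ) / 2) * (H - H') + (ξ - ξ') * (H' / 2) := by
      have : 6 / (H * H') * (H - H') = 6 / H' - 6 / H := by
        field_simp [show H ≠ 0 by linarith, show H' ≠ 0 by linarith]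
      rw [this]
      unfold bottom at hb
      linarith
    have e2 : 6 / 5 * |H - H'| ≤ 1 / 10 * |H - H'| := by
      have h65 : 6 / 5 ≤ 6 / (H * H') := div_le_div_of_nonneg_left (by norm_num) hp h5
      calc 6 / 5 * |H - H'| ≤ 6 / (H * H') * |H - H'| :=
            mul_le_mul_of_nonneg_right h65 (abs_nonneg _)
        _ = |6 / (H * H') * (H - H')| := by rw [abs_mul, abs_of_pos (div_pos (by norm_num) hp)]
        _ = |-((ζ - ξ) / 2) * (H - H') + (ξ - ξ') * (H' / 2)| := by rw [e1]
        _ ≤ |-((ζ - ξ) / 2)| * |H - H'| + |ξ - ξ'| * |H' / 2| := by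
            rw [← abs_mul, ← abs_mul]; exact abs_add_le _ _
        _ ≤ 1 / 50 * |H - H'| + (1 / 40 * |H - H'|) * 2 := by
            refine add_le_add (mul_le_mul_of_nonneg_right ?_ (abs_nonneg _))
              (mul_le_mul hx ?_ (abs_nonneg _) (by positivity))
            · exact abs_le.2 ⟨by linarith, by linarith⟩
            · exact abs_le.2 ⟨by linarith, by linarith⟩
        _ ≤ 1 / 10 * |H - H'| := by linarith [abs_nonneg (H - H')]
    have e3 : |H - H'| = 0 := by linarith [abs_nonneg (H - H')]
    rw [e3, mul_zero] at hx
    exact ⟨by linarith [abs_eq_zero.1 e3],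
      by linarith [abs_eq_zero.1 (le_antisymm hx (abs_nonneg _))]⟩
  · intro H ξ H' ξ' h h' he hy
    have hx := hξζ H ξ H' ξ' h h' he
    obtain ⟨h1, h2⟩ := hnear H ξ h
    obtain ⟨h1', h2'⟩ := hnear H' ξ' h'
    have a2 := (hstrict H ξ H' ξ' h1 h2 h1' h2').2.1
    change H - (ψ (H, ξ)).2.1 = H' - (ψ (H', ξ')).2.1 at hy
    -- The derivative of `H - y` with respect to `H` is 4 + 2√3 > 7, which dominates the remaining
    -- terms.
    rw [show (ψ (H, ξ)).2.1 - (ψ (H', ξ')).2.1 = H - H' by linarith,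
      show H - H' - ((-3 - 2 * √3) * (H - H') + μ * (ξ - ξ')) =
        (4 + 2 * √3) * (H - H') - μ * (ξ - ξ') by ring] at a2
    have a3 := abs_sub_abs_le_abs_sub ((4 + 2 * √3) * (H - H')) (μ * (ξ - ξ'))
    rw [abs_mul, abs_mul, abs_of_pos (show 0 < 4 + 2 * √3 by linarith),
      abs_of_pos (show 0 < μ by linarith)] at a3
    have e3 : |H - H'| = 0 := by
      refine le_antisymm ?_ (abs_nonneg _)
      linarith [abs_nonneg (H - H'), abs_nonneg (ξ - ξ'),
        mul_le_mul_of_nonneg_right (show 7 ≤ 4 + 2 * √3 by linarith) (abs_nonneg (H - H')),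
        mul_le_mul_of_nonneg_right hμ2.le (abs_nonneg (ξ - ξ'))]
    rw [e3, mul_zero] at hx
    exact ⟨by linarith [abs_eq_zero.1 e3],
      by linarith [abs_eq_zero.1 (le_antisymm hx (abs_nonneg _))]⟩
  · intro H ξ H' ξ' h h'
    obtain ⟨c1, -, -⟩ := hbase H ξ h
    show bottom H ξ (ψ (H, ξ)).1 < H' * √(2 + (ψ (H, ξ)).1 ^ 2)
    have hs := hsq (ψ (H, ξ)).1 (by linarith)
    set ζ := (ψ (H, ξ)).1
    have hH := h.H_lower
    have hHu := h.H_upper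
    have hH' := h'.H_lower
    have hζ := abs_le.1 c1
    have hξ := abs_le.1 h.ξ_abs
    -- At the rhombus both lengths equal 3; the extra height shortens the base below 3 and keeps the
    -- leg at 3 or more.
    have h6 : 6 / H ≤ 3 - 5 * υ := by rw [div_le_iff₀ (by linarith)]; nlinarith only [hH, hHu, hυ0, hυ1]
    have hm : -((ζ - ξ) * H / 2) ≤ 4 * υ := by
      nlinarith only [hζ.1, hξ.2, hH, hHu, hυ0, hυ1]
    have hl : 3 ≤ H' * √(2 + ζ ^ 2) := by
      calc (3 : ℝ) ≤ (2 + 4 * υ) * (3 / 2 - υ) := by nlinarith only [hυ0, hυ1]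
        _ ≤ _ := mul_le_mul (by linarith) hs (by linarith) (by linarith)
    unfold bottom
    linarith

end PlaneTiling

/-! ### Convex quadrangles in rescaled coordinates. -/

namespace PlaneTiling

open Real Set

/-- The point of the plane with the given coordinates, the second one rescaled by `√2`. -/
noncomputable def pt : (ℝ × ℝ) ≃L[ℝ] Plane :=
  LinearEquiv.toContinuousLinearEquiv
    { toFun := fun u => !₂[u.1, √2 * u.2]
      invFun := fun x => (x 0, x 1 / √2)
      map_add' := fun u v => by ext i; fin_cases i <;> simp [mul_add]
      map_smul' := fun c u => by ext i; fin_cases i <;> simp [mul_left_comm]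
      left_inv := fun u => by simp
      right_inv := fun x => by ext i; fin_cases i <;> simp [mul_div_cancel₀] }

theorem pt_apply (u : ℝ × ℝ) : pt u = !₂[u.1, √2 * u.2] := rfl

theorem dist_pt (u v : ℝ × ℝ) : dist (pt u) (pt v) = √(sqd u v) := by
  rw [EuclideanSpace.dist_eq, Fin.sum_univ_two, pt_apply, pt_apply, Real.dist_eq, Real.dist_eq]
  simp only [sq_abs, sqd]
  congr 1
  have : √2 ^ 2 = 2 := Real.sq_sqrt (by norm_num)
  simp
  linear_combination (u.2 - v.2) ^ 2 * this

theorem sqd_nonneg (u v : ℝ × ℝ) : 0 ≤ sqd u v := by unfold sqd; positivity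

theorem sqd_self (u : ℝ × ℝ) : sqd u u = 0 := by simp [sqd]

theorem sqd_comm (u v : ℝ × ℝ) : sqd u v = sqd v u := by unfold sqd; ring

/-- The quadrangle with the given vertices. -/
noncomputable def quad (a b c d : ℝ × ℝ) : Polygon Plane 4 := ⟨![pt a, pt b, pt c, pt d]⟩

/-- The region of a quadrangle, in rescaled coordinates. -/
def hull (a b c d : ℝ × ℝ) : Set (ℝ × ℝ) := convexHull ℝ {a, b, c, d}

theorem region_quad (a b c d : ℝ × ℝ) : region (quad a b c d) = pt '' hull a b c d := by
  have : Set.range (quad a b c d) = pt '' {a, b, c, d} := by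
    simp [quad, image_insert_eq, Matrix.range_cons]
    ext x; simp; tauto
  rw [region, this, hull]
  exact ((pt : (ℝ × ℝ) →L[ℝ] Plane).toLinearMap.image_convexHull _).symm

theorem turn_rotate (a b c : ℝ × ℝ) : turn a b c = turn b c a := by unfold turn; ring

theorem IsCCW.rotate {a b c d : ℝ × ℝ} (h : IsCCW a b c d) : IsCCW b c d a :=
  ⟨h.bcd, h.cda, h.dab, h.abc⟩

theorem turn_combination {α β : ℝ} (h : α + β = 1) (a b u v : ℝ × ℝ) :
    turn a b (α • u + β • v) = α * turn a b u + β * turn a b v := by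
  obtain rfl : β = 1 - α := by linarith
  simp [turn]
  ring

/-- The barycentric coordinates of `w` are the ratios of its three `turn`s to `turn a b c`. -/
theorem mem_of_turn_nonneg {s : Set (ℝ × ℝ)} (hs : Convex ℝ s) {a b c w : ℝ × ℝ} (ha : a ∈ s)
    (hb : b ∈ s) (hc : c ∈ s) (hD : 0 < turn a b c) (h1 : 0 ≤ turn a b w) (h2 : 0 ≤ turn b c w)
    (h3 : 0 ≤ turn c a w) : w ∈ s := by
  have hsum : turn b c w + turn c a w + turn a b w = turn a b c := by unfold turn; ring
  have := hs.sum_mem (t := Finset.univ)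
    (w := ![turn b c w / turn a b c, turn c a w / turn a b c, turn a b w / turn a b c])
    (z := ![a, b, c])
    (by intro i _; fin_cases i <;> simp <;> positivity)
    (by rw [Fin.sum_univ_three]; simp; rw [← add_div, ← add_div, hsum, div_self hD.ne'])
    (by intro i _; fin_cases i <;> simp [ha, hb, hc])
  convert this
  rw [Fin.sum_univ_three]
  ext
  · simp
    field_simp
    unfold turn; ring
  · simp
    field_simp
    unfold turn; ring

theorem mem_hull_iff {a b c d : ℝ × ℝ} (h : IsCCW a b c d) (w : ℝ × ℝ) :
    w ∈ hull a b c d ↔ 0 ≤ turn a b w ∧ 0 ≤ turn b c w ∧ 0 ≤ turn c d w ∧ 0 ≤ turn d a w := by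
  have key : ∀ p q u v : ℝ × ℝ, IsCCW p q u v → ∀ w ∈ convexHull ℝ {p, q, u, v}, 0 ≤ turn p q w := by
    intro p q u v hc w hw
    have hconv : Convex ℝ {w | 0 ≤ turn p q w} := by
      intro x hx y hy α β hα hβ hαβ
      rw [mem_ofPred_eq] at *
      rw [turn_combination hαβ]
      positivity
    refine convexHull_min ?_ hconv hw
    rintro x (rfl | rfl | rfl | rfl)
    · simp [turn]
    · simp [turn, mul_comm]
    · exact hc.abc.le
    · rw [mem_ofPred_eq, turn_rotate, turn_rotate]; exact hc.dab.le
  constructor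
  · intro hw
    refine ⟨key a b c d h w hw, key b c d a h.rotate w ?_, key c d a b h.rotate.rotate w ?_,
      key d a b c h.rotate.rotate.rotate w ?_⟩
    all_goals
      convert (show w ∈ convexHull ℝ {a, b, c, d} from hw) using 2
      ext x
      simp only [mem_insert_iff, mem_singleton_iff]
      tauto
  · rintro ⟨h1, h2, h3, h4⟩
    have hs := convex_convexHull ℝ ({a, b, c, d} : Set (ℝ × ℝ))
    have hin : ∀ x ∈ ({a, b, c, d} : Set (ℝ × ℝ)), x ∈ convexHull ℝ {a, b, c, d} :=
      fun x hx => subset_convexHull _ _ hx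
    -- The diagonal `ac` decides which of two triangles contains `w`.
    rcases le_total 0 (turn c a w) with h5 | h5
    · exact mem_of_turn_nonneg hs (hin a (by simp)) (hin b (by simp)) (hin c (by simp)) h.abc h1 h2 h5
    · exact mem_of_turn_nonneg hs (hin c (by simp)) (hin d (by simp)) (hin a (by simp)) h.cda h3 h4
        (by have : turn a c w = - turn c a w := by unfold turn; ring
            linarith)

theorem sSameSide_pt {a b c d : ℝ × ℝ} (hc : 0 < turn a b c) (hd : 0 < turn a b d) :
    (line[ℝ, pt a, pt b]).SSameSide (pt c) (pt d) := by
  have hnot : ∀ x, 0 < turn a b x → pt x ∉ line[ℝ, pt a, pt b] := by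
    intro x hx hmem
    obtain ⟨r, hr⟩ := mem_affineSpan_pair_iff_exists_lineMap_eq.1 hmem
    have : AffineMap.lineMap a b r = x := by
      apply pt.injective
      rw [← hr, AffineMap.lineMap_apply_module, AffineMap.lineMap_apply_module]
      simp
    rw [AffineMap.lineMap_apply_module] at this
    rw [← this, turn_combination (by ring)] at hx
    simp [turn, mul_comm] at hx
  rw [AffineSubspace.sSameSide_iff_exists_left (left_mem_affineSpan_pair ℝ (pt a) (pt b))]
  -- The witness is the point of the line from which `d` is seen in the direction of `c - a`.
  refine ⟨hnot c hc, hnot d hd, pt (a + (turn a d c / turn a b c) • (b - a)), ?_, ?_⟩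
  · rw [mem_affineSpan_pair_iff_exists_lineMap_eq]
    refine ⟨turn a d c / turn a b c, ?_⟩
    rw [AffineMap.lineMap_apply_module']
    simp [add_comm]
  · have : pt d -ᵥ pt (a + (turn a d c / turn a b c) • (b - a)) =
        (turn a b d / turn a b c) • (pt c -ᵥ pt a) := by
      rw [vsub_eq_sub, vsub_eq_sub, ← map_sub, ← map_sub, ← map_smul]
      congr 1
      ext
      · simp
        field_simp
        unfold turn; ring
      · simp
        field_simp
        unfold turn; ring
    rw [this]
    exact SameRay.sameRay_nonneg_smul_right _ (by positivity)

theorem isConvexQuadrangle_quad {a b c d : ℝ × ℝ} (h : IsCCW a b c d) :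
    IsConvexQuadrangle (quad a b c d) := by
  have h1 : ∀ a b c : ℝ × ℝ, turn a b c = turn c a b := fun a b c => by unfold turn; ring
  intro i
  fin_cases i
  · exact sSameSide_pt h.abc (by rw [h1]; exact h.dab)
  · exact sSameSide_pt h.bcd (by rw [h1]; exact h.abc)
  · exact sSameSide_pt h.cda (by rw [h1]; exact h.bcd)
  · exact sSameSide_pt h.dab (by rw [h1]; exact h.cda)

theorem perimeter_quad (a b c d : ℝ × ℝ) :
    perimeter (quad a b c d) = √(sqd a b) + √(sqd b c) + √(sqd c d) + √(sqd d a) := by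
  rw [perimeter, Fin.sum_univ_four, ← dist_pt, ← dist_pt, ← dist_pt, ← dist_pt]
  rfl

/-- Sets that are separated by a line have disjoint interiors. -/
theorem disjoint_interior_of_separated {S T : Set (ℝ × ℝ)} (α β γ : ℝ) (h0 : 0 < α ^ 2 + β ^ 2)
    (hS : ∀ w ∈ S, α * w.1 + β * w.2 ≤ γ) (hT : ∀ w ∈ T, γ ≤ α * w.1 + β * w.2) :
    Disjoint (interior S) (interior T) := by
  rw [Set.disjoint_left]
  intro w hw hw'
  have hc : Continuous fun t : ℝ => ((w.1 + t * α, w.2 + t * β) : ℝ × ℝ) := by fun_prop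
  have hev : ∀ᶠ t in nhds (0 : ℝ), ((w.1 + t * α, w.2 + t * β) : ℝ × ℝ) ∈ interior S := by
    apply hc.continuousAt.eventually_mem
    simpa using isOpen_interior.mem_nhds hw
  -- A common interior point, pushed slightly along the normal, would stay in `S` and yet violate
  -- the inequality for `S`.
  obtain ⟨t, ht, ht0⟩ := ((hev.filter_mono nhdsWithin_le_nhds).and
    (self_mem_nhdsWithin : Ioi (0 : ℝ) ∈ nhdsWithin 0 (Ioi 0))).exists
  have h1 := hS _ (interior_subset ht)
  have h2 := hT _ (interior_subset hw')
  have h3 : 0 < t * (α ^ 2 + β ^ 2) := mul_pos ht0 h0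
  simp only at h1
  nlinarith

theorem disjoint_interior_image_pt {S T : Set (ℝ × ℝ)} (h : Disjoint (interior S) (interior T)) :
    Disjoint (interior (pt '' S)) (interior (pt '' T)) := by
  have e : ∀ S : Set (ℝ × ℝ), interior (pt '' S) = pt '' interior S := fun S =>
    (pt.toHomeomorph.image_interior S).symm
  rw [e, e]
  exact Set.disjoint_image_of_injective pt.injective h

end PlaneTiling

/-! ### Areas. -/

namespace PlaneTiling

open Real Set MeasureTheory

theorem volume_standard_triangle :
    volume {w : ℝ × ℝ | 0 ≤ w.1 ∧ 0 ≤ w.2 ∧ w.1 + w.2 ≤ 1} = ENNReal.ofReal (1 / 2) := by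
  have hm : MeasurableSet {w : ℝ × ℝ | 0 ≤ w.1 ∧ 0 ≤ w.2 ∧ w.1 + w.2 ≤ 1} := by
    apply IsClosed.measurableSet
    exact (isClosed_le continuous_const continuous_fst).inter
      ((isClosed_le continuous_const continuous_snd).inter
        (isClosed_le (continuous_fst.add continuous_snd) continuous_const))
  rw [Measure.volume_eq_prod, Measure.prod_apply hm]
  have hslice : ∀ x : ℝ, volume (Prod.mk x ⁻¹' {w : ℝ × ℝ | 0 ≤ w.1 ∧ 0 ≤ w.2 ∧ w.1 + w.2 ≤ 1}) =
      (Icc (0 : ℝ) 1).indicator (fun x => ENNReal.ofReal (1 - x)) x := by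
    intro x
    by_cases hx : x ∈ Icc (0 : ℝ) 1
    · rw [indicator_of_mem hx]
      have : Prod.mk x ⁻¹' {w : ℝ × ℝ | 0 ≤ w.1 ∧ 0 ≤ w.2 ∧ w.1 + w.2 ≤ 1} = Icc 0 (1 - x) := by
        ext y
        simp only [mem_preimage, mem_ofPred_eq, mem_Icc]
        constructor
        · rintro ⟨-, h1, h2⟩; exact ⟨h1, by linarith⟩
        · rintro ⟨h1, h2⟩; exact ⟨hx.1, h1, by linarith⟩
      rw [this, Real.volume_Icc, sub_zero]
    · rw [indicator_of_notMem hx]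
      have : Prod.mk x ⁻¹' {w : ℝ × ℝ | 0 ≤ w.1 ∧ 0 ≤ w.2 ∧ w.1 + w.2 ≤ 1} = ∅ := by
        ext y
        simp only [mem_preimage, mem_ofPred_eq, mem_empty_iff_false, iff_false]
        rintro ⟨h1, h2, h3⟩
        exact hx ⟨h1, by linarith⟩
      rw [this, measure_empty]
  simp_rw [hslice]
  rw [lintegral_indicator measurableSet_Icc,
    ← ofReal_integral_eq_lintegral_ofReal]
  · congr 1
    rw [integral_Icc_eq_integral_Ioc, ← intervalIntegral.integral_of_le (by norm_num)]
    rw [intervalIntegral.integral_sub (by simp) (by simp)]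
    simp
    norm_num
  · exact (Continuous.integrableOn_Icc (by fun_prop))
  · refine (ae_restrict_iff' measurableSet_Icc).2 (Filter.Eventually.of_forall fun x hx => ?_)
    simpa using hx.2

/-- The closed triangle with the given vertices, counterclockwise. -/
def triangle (a b c : ℝ × ℝ) : Set (ℝ × ℝ) :=
  {w | 0 ≤ turn a b w ∧ 0 ≤ turn b c w ∧ 0 ≤ turn c a w}

theorem isClosed_triangle (a b c : ℝ × ℝ) : IsClosed (triangle a b c) := by
  have h : ∀ a b : ℝ × ℝ, IsClosed {w | 0 ≤ turn a b w} := fun a b =>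
    isClosed_le continuous_const (by unfold turn; fun_prop)
  exact (h a b).inter ((h b c).inter (h c a))

/-- The triangle is an affine image of the standard one, with determinant `turn a b c`. -/
theorem volume_triangle {a b c : ℝ × ℝ} (h : 0 < turn a b c) :
    volume (triangle a b c) = ENNReal.ofReal (turn a b c / 2) := by
  set L : ℝ × ℝ →ₗ[ℝ] ℝ × ℝ := Matrix.toLin (Module.Basis.finTwoProd ℝ) (Module.Basis.finTwoProd ℝ)
    !![b.1 - a.1, c.1 - a.1; b.2 - a.2, c.2 - a.2] with hL
  have hLa : ∀ w, L w = ((b.1 - a.1) * w.1 + (c.1 - a.1) * w.2,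
      (b.2 - a.2) * w.1 + (c.2 - a.2) * w.2) := fun w => Matrix.toLin_finTwoProd_apply _ _ _ _ w
  have hdet : LinearMap.det L = turn a b c := by
    rw [hL, LinearMap.det_toLin, Matrix.det_fin_two_of, turn]; ring
  have himg : triangle a b c =
      (fun w => a + w) '' (L '' {w : ℝ × ℝ | 0 ≤ w.1 ∧ 0 ≤ w.2 ∧ w.1 + w.2 ≤ 1}) := by
    ext w
    simp only [triangle, mem_ofPred_eq, mem_image]
    constructor
    · rintro ⟨h1, h2, h3⟩
      refine ⟨w - a, ⟨(turn c a w / turn a b c, turn a b w / turn a b c), ⟨?_, ?_, ?_⟩, ?_⟩, ?_⟩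
      · simp only; positivity
      · simp only; positivity
      · simp only
        rw [← add_div, div_le_one h]
        have : turn b c w + turn c a w + turn a b w = turn a b c := by unfold turn; ring
        linarith
      · rw [hLa]
        ext
        · simp only [Prod.fst_sub]
          field_simp
          unfold turn; ring
        · simp only [Prod.snd_sub]
          field_simp
          unfold turn; ring
      · simp
    · rintro ⟨_, ⟨u, ⟨h1, h2, h3⟩, rfl⟩, rfl⟩
      rw [hLa]
      have e1 : turn a b (a + ((b.1 - a.1) * u.1 + (c.1 - a.1) * u.2,
          (b.2 - a.2) * u.1 + (c.2 - a.2) * u.2)) = u.2 * turn a b c := by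
        simp [turn]; ring
      have e2 : turn b c (a + ((b.1 - a.1) * u.1 + (c.1 - a.1) * u.2,
          (b.2 - a.2) * u.1 + (c.2 - a.2) * u.2)) = (1 - u.1 - u.2) * turn a b c := by
        simp [turn]; ring
      have e3 : turn c a (a + ((b.1 - a.1) * u.1 + (c.1 - a.1) * u.2,
          (b.2 - a.2) * u.1 + (c.2 - a.2) * u.2)) = u.1 * turn a b c := by
        simp [turn]; ring
      rw [e1, e2, e3]
      exact ⟨by positivity, mul_nonneg (by linarith) h.le, by positivity⟩
  rw [himg, image_add_left, measure_preimage_add, Measure.addHaar_image_linearMap,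
    volume_standard_triangle, hdet, abs_of_pos h, ← ENNReal.ofReal_mul h.le]
  congr 1
  ring

theorem volume_line {a c : ℝ × ℝ} (b : ℝ × ℝ) (h : 0 < turn a b c) :
    volume {w | turn a c w = 0} = 0 := by
  refine measure_mono_null (t := line[ℝ, a, c]) ?_ (Measure.addHaar_affineSubspace _ _ ?_)
  · intro w hw
    rw [SetLike.mem_coe, mem_affineSpan_pair_iff_exists_lineMap_eq]
    refine ⟨turn a b w / turn a b c, ?_⟩
    rw [AffineMap.lineMap_apply_module']
    have hw : turn a c w = 0 := hw
    ext
    · simp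
      field_simp
      unfold turn at *
      linear_combination (b.1 - a.1) * hw
    · simp
      field_simp
      unfold turn at *
      linear_combination (b.2 - a.2) * hw
  · intro htop
    have : b ∈ line[ℝ, a, c] := by rw [htop]; trivial
    obtain ⟨r, rfl⟩ := mem_affineSpan_pair_iff_exists_lineMap_eq.1 this
    simp [turn, AffineMap.lineMap_apply_module'] at h
    ring_nf at h
    exact lt_irrefl _ h

theorem volume_hull {a b c d : ℝ × ℝ} (h : IsCCW a b c d) :
    volume (hull a b c d) = ENNReal.ofReal ((turn a b c + turn c d a) / 2) := by
  have hU : hull a b c d = triangle a b c ∪ triangle c d a := by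
    ext w
    have e : turn a c w = - turn c a w := by unfold turn; ring
    rw [mem_hull_iff h]
    constructor
    · rintro ⟨h1, h2, h3, h4⟩
      rcases le_total 0 (turn c a w) with h5 | h5
      · exact Or.inl ⟨h1, h2, h5⟩
      · exact Or.inr ⟨h3, h4, by linarith⟩
    · have hs := convex_convexHull ℝ ({a, b, c, d} : Set (ℝ × ℝ))
      have hin : ∀ x ∈ ({a, b, c, d} : Set (ℝ × ℝ)), x ∈ hull a b c d :=
        fun x hx => subset_convexHull _ _ hx
      rintro (⟨h1, h2, h3⟩ | ⟨h1, h2, h3⟩)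
      · exact (mem_hull_iff h w).1 (mem_of_turn_nonneg hs (hin a (by simp)) (hin b (by simp))
          (hin c (by simp)) h.abc h1 h2 h3)
      · exact (mem_hull_iff h w).1 (mem_of_turn_nonneg hs (hin c (by simp)) (hin d (by simp))
          (hin a (by simp)) h.cda h1 h2 h3)
  have hI : volume (triangle a b c ∩ triangle c d a) = 0 := by
    refine measure_mono_null ?_ (volume_line b h.abc)
    rintro w ⟨⟨-, -, h1⟩, ⟨-, -, h2⟩⟩
    have e : turn a c w = - turn c a w := by unfold turn; ring
    show turn a c w = 0
    linarith
  rw [hU, ← add_zero (volume _), ← hI, measure_union_add_inter _ (isClosed_triangle c d a).measurableSet,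
    volume_triangle h.abc, volume_triangle h.cda,
    ← ENNReal.ofReal_add (by linarith [h.abc]) (by linarith [h.cda])]
  congr 1
  ring

theorem volume_image_pt (S : Set (ℝ × ℝ)) :
    volume (pt '' S) = ENNReal.ofReal (√2) * volume S := by
  set L : ℝ × ℝ →ₗ[ℝ] ℝ × ℝ := Matrix.toLin (Module.Basis.finTwoProd ℝ) (Module.Basis.finTwoProd ℝ)
    !![1, 0; 0, √2] with hL
  have hLa : ∀ w, L w = (w.1, √2 * w.2) := fun w => by
    rw [hL, Matrix.toLin_finTwoProd_apply]; simp
  have hdet : LinearMap.det L = √2 := by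
    rw [hL, LinearMap.det_toLin, Matrix.det_fin_two_of]; ring
  let e : Plane ≃ᵐ ℝ × ℝ := (MeasurableEquiv.toLp 2 (Fin 2 → ℝ)).symm.trans MeasurableEquiv.finTwoArrow
  have he : MeasurePreserving e volume volume :=
    (volume_preserving_finTwoArrow ℝ).comp
      (EuclideanSpace.volume_preserving_symm_measurableEquiv_toLp (Fin 2))
  have himg : pt '' S = e ⁻¹' (L '' S) := by
    have hpt : ∀ u, e (pt u) = L u := fun u => by rw [hLa]; rfl
    ext x
    constructor
    · rintro ⟨u, hu, rfl⟩
      exact ⟨u, hu, (hpt u).symm⟩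
    · rintro ⟨u, hu, hux⟩
      exact ⟨u, hu, e.injective (by rw [hpt, hux])⟩
  rw [himg, he.measure_preimage_equiv, Measure.addHaar_image_linearMap, hdet,
    abs_of_nonneg (Real.sqrt_nonneg _)]

theorem volume_region_quad {a b c d : ℝ × ℝ} (h : IsCCW a b c d) :
    volume (region (quad a b c d)) = ENNReal.ofReal (√2 * ((turn a b c + turn c d a) / 2)) := by
  rw [region_quad, volume_image_pt, volume_hull h, ← ENNReal.ofReal_mul (Real.sqrt_nonneg _)]

end PlaneTiling

/-! ### Congruences act on vertices. -/

namespace PlaneTiling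

open Real Set

theorem eq_of_turn_eq_zero {a b d w : ℝ × ℝ} (h : 0 < turn d a b) (h1 : turn a b w = 0)
    (h2 : turn d a w = 0) : w = a := by
  unfold turn at *
  have e1 : (w.1 - a.1) * ((a.1 - d.1) * (b.2 - d.2) - (a.2 - d.2) * (b.1 - d.1)) = 0 := by
    linear_combination (b.1 - a.1) * h2 - (a.1 - d.1) * h1
  have e2 : (w.2 - a.2) * ((a.1 - d.1) * (b.2 - d.2) - (a.2 - d.2) * (b.1 - d.1)) = 0 := by
    linear_combination (b.2 - a.2) * h2 - (a.2 - d.2) * h1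
  ext
  · linarith [(mul_eq_zero.1 e1).resolve_right h.ne']
  · linarith [(mul_eq_zero.1 e2).resolve_right h.ne']

theorem hull_rotate (a b c d : ℝ × ℝ) : hull a b c d = hull b c d a := by
  unfold hull
  congr 1
  ext x
  simp only [mem_insert_iff, mem_singleton_iff]
  tauto

/-- The linear conditions of the two edges at `a` are nonnegative on the hull and vanish at `a`.
They therefore vanish at the ends of any segment through `a`, and only `a` lies on both edge lines.
-/
theorem IsCCW.mem_extremePoints {a b c d : ℝ × ℝ} (h : IsCCW a b c d) :
    a ∈ (hull a b c d).extremePoints ℝ := by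
  rw [mem_extremePoints_iff_left]
  refine ⟨subset_convexHull _ _ (by simp), fun x hx y hy hxy => ?_⟩
  obtain ⟨α, β, hα, hβ, hαβ, rfl⟩ := hxy
  rw [mem_hull_iff h] at hx hy
  set a := α • x + β • y with ha
  have h1 : α * turn a b x + β * turn a b y = 0 := by
    rw [← turn_combination hαβ, ← ha]; simp [turn]
  have h2 : α * turn d a x + β * turn d a y = 0 := by
    rw [← turn_combination hαβ, ← ha]; simp [turn, mul_comm]
  refine eq_of_turn_eq_zero h.dab ?_ ?_
  · have := mul_nonneg hα.le hx.1
    have := mul_nonneg hβ.le hy.1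
    exact (mul_eq_zero.1 (by linarith : α * turn a b x = 0)).resolve_left hα.ne'
  · have := mul_nonneg hα.le hx.2.2.2
    have := mul_nonneg hβ.le hy.2.2.2
    exact (mul_eq_zero.1 (by linarith : α * turn d a x = 0)).resolve_left hα.ne'

theorem IsCCW.extremePoints_hull {a b c d : ℝ × ℝ} (h : IsCCW a b c d) :
    (hull a b c d).extremePoints ℝ = {a, b, c, d} := by
  refine Subset.antisymm extremePoints_convexHull_subset ?_
  rintro x (rfl | rfl | rfl | rfl)
  · exact h.mem_extremePoints
  · rw [hull_rotate]; exact h.rotate.mem_extremePoints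
  · rw [hull_rotate, hull_rotate]; exact h.rotate.rotate.mem_extremePoints
  · rw [hull_rotate, hull_rotate, hull_rotate]; exact h.rotate.rotate.rotate.mem_extremePoints

/-- A congruence of quadrangles maps vertices to vertices. -/
theorem exists_vertex_map {a b c d a' b' c' d' : ℝ × ℝ} (h : IsCCW a b c d)
    (h' : IsCCW a' b' c' d')
    (hc : SetCongruent (region (quad a b c d)) (region (quad a' b' c' d'))) :
    ∃ g : ℝ × ℝ → ℝ × ℝ, (∀ u v, sqd (g u) (g v) = sqd u v) ∧
      ∀ u ∈ ({a, b, c, d} : Set (ℝ × ℝ)), g u ∈ ({a', b', c', d'} : Set (ℝ × ℝ)) := by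
  obtain ⟨f, hf⟩ := hc
  rw [region_quad, region_quad] at hf
  -- By Mazur–Ulam the isometry is affine, hence preserves extreme points.
  let φ := f.toRealAffineIsometryEquiv.toAffineEquiv
  have hφ : ∀ x, φ x = f x := fun x => rfl
  let g : ℝ × ℝ → ℝ × ℝ := fun u => pt.symm (f (pt u))
  have hg : ∀ u, pt (g u) = f (pt u) := fun u => pt.apply_symm_apply _
  let A : (ℝ × ℝ) ≃ᵃ[ℝ] (ℝ × ℝ) :=
    (pt.toLinearEquiv.toAffineEquiv.trans φ).trans pt.symm.toLinearEquiv.toAffineEquiv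
  have hA : ∀ u, A u = g u := fun u => rfl
  have himg : g '' hull a b c d = hull a' b' c' d' := by
    apply pt.injective.image_injective
    rw [← hf, image_image, image_image]
    simp only [hg]
  refine ⟨g, fun u v => ?_, fun u hu => ?_⟩
  · have h1 : √(sqd (g u) (g v)) = √(sqd u v) := by
      rw [← dist_pt, ← dist_pt, hg, hg, f.dist_eq]
    exact (Real.sqrt_inj (sqd_nonneg _ _) (sqd_nonneg _ _)).1 h1
  · rw [← h'.extremePoints_hull]
    rw [← h.extremePoints_hull, mem_extremePoints_iff_left] at hu
    rw [mem_extremePoints_iff_left, ← himg]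
    refine ⟨mem_image_of_mem _ hu.1, ?_⟩
    rintro _ ⟨x, hx, rfl⟩ _ ⟨y, hy, rfl⟩ hxy
    have : g u ∈ A '' openSegment ℝ x y := by
      have e := image_openSegment ℝ (A : (ℝ × ℝ) →ᵃ[ℝ] (ℝ × ℝ)) x y
      rw [show (A '' openSegment ℝ x y) = openSegment ℝ (A x) (A y) from e]
      exact hxy
    obtain ⟨w, hw, hwu⟩ := this
    have : w = u := A.injective hwu
    rw [hu.2 x hx y hy (this ▸ hw)]

/-- Only the pair `a, v` exceeds 17/2 and only `v, p` is a pair of distinct vertices below 2; the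
shared vertex is `v`. -/
theorem IsSpike.map_eq {a v p o a' v' p' o' : ℝ × ℝ} (h : IsSpike a v p o)
    (h' : IsSpike a' v' p' o') {g : ℝ × ℝ → ℝ × ℝ} (hg : ∀ u v, sqd (g u) (g v) = sqd u v)
    (hm : ∀ u ∈ ({a, v, p, o} : Set (ℝ × ℝ)), g u ∈ ({a', v', p', o'} : Set (ℝ × ℝ))) :
    g a = a' ∧ g v = v' ∧ g p = p' := by
  have av := h.av
  have vp := h.vp
  have ap := h.ap
  have c1 := sqd_comm a' v'
  have c2 := sqd_comm a' p'
  have c3 := sqd_comm a' o'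
  have c4 := sqd_comm v' p'
  have c5 := sqd_comm v' o'
  have c6 := sqd_comm p' o'
  obtain ⟨k1, k2, ⟨k3, k4⟩, ⟨k5, k6⟩, ⟨k7, k8⟩, ⟨k9, k10⟩⟩ := h'
  rw [← hg] at av vp ap
  have ha := hm a (by simp)
  have hv := hm v (by simp)
  have hp := hm p (by simp)
  simp only [mem_insert_iff, mem_singleton_iff] at ha hv hp
  rcases ha with ha | ha | ha | ha <;> rcases hv with hv | hv | hv | hv <;>
    rw [ha, hv] at av <;>
    first
    | (exfalso; linarith [sqd_self a', sqd_self v', sqd_self p', sqd_self o'])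
    | skip
  all_goals
    rcases hp with hp | hp | hp | hp <;> rw [hv, hp] at vp <;> rw [ha, hp] at ap <;>
    first
    | exact ⟨ha, hv, hp⟩
    | (exfalso; linarith [sqd_self a', sqd_self v', sqd_self p', sqd_self o', ap.1, ap.2])

/-- The long diagonal is the only distance above 10, and of the other two vertices only `v` is more
than 7/2 from both its ends. Swapping these ends cannot be excluded here, the undeformed kite being
symmetric. -/
theorem IsKite.map_eq {p v q o p' v' q' o' : ℝ × ℝ} (h : IsKite p v q o)
    (h' : IsKite p' v' q' o') {g : ℝ × ℝ → ℝ × ℝ} (hg : ∀ u v, sqd (g u) (g v) = sqd u v)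
    (hm : ∀ u ∈ ({p, v, q, o} : Set (ℝ × ℝ)), g u ∈ ({p', v', q', o'} : Set (ℝ × ℝ))) :
    g v = v' ∧ (g p = p' ∧ g q = q' ∨ g p = q' ∧ g q = p') := by
  have pq := h.pq
  have pv := h.pv.1
  have qv := h.qv.1
  have c1 := sqd_comm p' v'
  have c2 := sqd_comm p' q'
  have c3 := sqd_comm p' o'
  have c4 := sqd_comm v' q'
  have c5 := sqd_comm v' o'
  have c6 := sqd_comm q' o'
  obtain ⟨k1, ⟨k3, k4⟩, ⟨k5, k6⟩, ⟨k7, k8⟩, ⟨k9, k10⟩, ⟨k11, k12⟩⟩ := h'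
  rw [← hg] at pq pv qv
  have hp := hm p (by simp)
  have hq := hm q (by simp)
  have hv := hm v (by simp)
  simp only [mem_insert_iff, mem_singleton_iff] at hp hq hv
  rcases hp with hp | hp | hp | hp <;> rcases hq with hq | hq | hq | hq <;>
    rw [hp, hq] at pq <;>
    first
    | (exfalso; linarith [sqd_self p', sqd_self v', sqd_self q', sqd_self o'])
    | skip
  all_goals
    rcases hv with hv | hv | hv | hv <;> rw [hp, hv] at pv <;> rw [hq, hv] at qv <;>
    first
    | exact ⟨hv, Or.inl ⟨hp, hq⟩⟩
    | exact ⟨hv, Or.inr ⟨hp, hq⟩⟩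
    | (exfalso; linarith [sqd_self p', sqd_self v', sqd_self q', sqd_self o'])

/-- Distinct vertices of a kite are more than 2 apart, so `v` and `p` would have the same image,
although their distances to `a` differ. -/
theorem not_spike_to_kite {a v p o p' v' q' o' : ℝ × ℝ} (h : IsSpike a v p o)
    (h' : IsKite p' v' q' o') {g : ℝ × ℝ → ℝ × ℝ} (hg : ∀ u v, sqd (g u) (g v) = sqd u v)
    (hm : ∀ u ∈ ({a, v, p, o} : Set (ℝ × ℝ)), g u ∈ ({p', v', q', o'} : Set (ℝ × ℝ))) : False := by
  have av := h.av
  have vp := h.vp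
  have ap := h.ap.2
  have c1 := sqd_comm p' v'
  have c2 := sqd_comm p' q'
  have c3 := sqd_comm p' o'
  have c4 := sqd_comm v' q'
  have c5 := sqd_comm v' o'
  have c6 := sqd_comm q' o'
  obtain ⟨k1, ⟨k3, k4⟩, ⟨k5, k6⟩, ⟨k7, k8⟩, ⟨k9, k10⟩, ⟨k11, k12⟩⟩ := h'
  rw [← hg] at av vp ap
  have hv := hm v (by simp)
  have hp := hm p (by simp)
  simp only [mem_insert_iff, mem_singleton_iff] at hv hp
  rcases hv with hv | hv | hv | hv <;> rcases hp with hp | hp | hp | hp <;>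
    rw [hv, hp] at vp <;> rw [hv] at av <;> rw [hp] at ap <;> linarith

theorem SetCongruent.symm {S T : Set Plane} (h : SetCongruent S T) : SetCongruent T S := by
  obtain ⟨f, rfl⟩ := h
  exact ⟨f.symm, by rw [image_image]; simp⟩

end PlaneTiling

/-! ### The parameters that the shape of a cell reveals. -/

namespace PlaneTiling

open Real Set

/-- Translation by `w`, followed by the half-turn about the origin if `s` is false. -/
def place (s : Bool) (w u : ℝ × ℝ) : ℝ × ℝ := if s then w + u else -(w + u)

theorem turn_place (s : Bool) (w a b c : ℝ × ℝ) :
    turn (place s w a) (place s w b) (place s w c) = turn a b c := by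
  cases s
  · simp [place, turn]; ring
  · simp [place, turn]

theorem sqd_place (s : Bool) (w a b : ℝ × ℝ) :
    sqd (place s w a) (place s w b) = sqd a b := by
  cases s
  · simp [place, sqd]; ring
  · simp [place, sqd]

theorem IsCCW.place {a b c d : ℝ × ℝ} (h : IsCCW a b c d) (s : Bool) (w : ℝ × ℝ) :
    IsCCW (place s w a) (place s w b) (place s w c) (place s w d) := by
  obtain ⟨h1, h2, h3, h4⟩ := h
  constructor <;> rw [turn_place] <;> assumption

theorem place_surjective (s : Bool) (w : ℝ × ℝ) : Function.Surjective (place s w) := by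
  intro u
  cases s
  · exact ⟨-u - w, by simp [place]⟩
  · exact ⟨u - w, by simp [place]⟩

theorem place_injective (s : Bool) (w : ℝ × ℝ) : Function.Injective (place s w) := by
  intro u v h
  cases s <;> simpa [place] using h

theorem image_place_hull (s : Bool) (w a b c d : ℝ × ℝ) :
    place s w '' hull a b c d = hull (place s w a) (place s w b) (place s w c) (place s w d) := by
  have e : ∃ f : (ℝ × ℝ) →ᵃ[ℝ] (ℝ × ℝ), ⇑f = place s w := by
    cases s
    · exact ⟨-(AffineMap.const ℝ _ w + AffineMap.id ℝ _), by ext u <;> simp [place]⟩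
    · exact ⟨AffineMap.const ℝ _ w + AffineMap.id ℝ _, by ext u <;> simp [place]⟩
  obtain ⟨f, hf⟩ := e
  rw [hull, hull, ← hf, f.image_convexHull]
  simp [image_insert_eq]

theorem exists_vertex_map_place {a b c d a' b' c' d' : ℝ × ℝ} (h : IsCCW a b c d)
    (h' : IsCCW a' b' c' d') {s s' : Bool} {w w' : ℝ × ℝ}
    (hc : SetCongruent (pt '' (place s w '' hull a b c d)) (pt '' (place s' w' '' hull a' b' c' d'))) :
    ∃ g : ℝ × ℝ → ℝ × ℝ, (∀ u v, sqd (g u) (g v) = sqd u v) ∧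
      ∀ u ∈ ({a, b, c, d} : Set (ℝ × ℝ)), g u ∈ ({a', b', c', d'} : Set (ℝ × ℝ)) := by
  rw [image_place_hull, image_place_hull, ← region_quad, ← region_quad] at hc
  obtain ⟨g, hg, hm⟩ := exists_vertex_map (h.place s w) (h'.place s' w') hc
  let e := Function.surjInv (place_surjective s' w')
  have he : ∀ u, place s' w' (e u) = u := Function.surjInv_eq _
  refine ⟨fun u => e (g (place s w u)), fun u v => ?_, fun u hu => ?_⟩
  · rw [← sqd_place s' w', he, he, hg, sqd_place]
  · have h1 : g (place s w u) ∈ place s' w' '' {a', b', c', d'} := by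
      simp only [image_insert_eq, image_singleton]
      apply hm
      have := mem_image_of_mem (place s w) hu
      simpa only [image_insert_eq, image_singleton] using this
    obtain ⟨x, hx, hxe⟩ := h1
    have : e (g (place s w u)) = x := place_injective s' w' (by rw [he, hxe])
    change e (g (place s w u)) ∈ _
    rwa [this]

namespace Dissection

variable {d d' : Dissection}

/-- The triangle `v₁ v₂ p` is preserved: its sides give the base and, through the angle at `v₂`, the
slope. -/
theorem eq_of_fst_map (hd : d.IsGood) (hd' : d'.IsGood) {g : ℝ × ℝ → ℝ × ℝ}
    (hg : ∀ u v, sqd (g u) (g v) = sqd u v)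
    (hm : ∀ u ∈ ({v₁, d.v₂, d.p, d.o} : Set (ℝ × ℝ)),
      g u ∈ ({v₁, d'.v₂, d'.p, d'.o} : Set (ℝ × ℝ))) :
    d.b = d'.b ∧ d.ζ = d'.ζ := by
  obtain ⟨h1, h2, h3⟩ := hd.spike.map_eq hd'.spike hg hm
  have e1 := hg v₁ d.v₂
  have e2 := hg d.v₂ d.p
  have e3 := hg v₁ d.p
  rw [h1, h2] at e1
  rw [h2, h3] at e2
  rw [h1, h3] at e3
  simp only [sqd, v₁, v₂, p] at e1 e2 e3
  have hb : d.b = d'.b := by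
    refine (sq_eq_sq₀ hd.b_pos.le hd'.b_pos.le).1 ?_
    linarith
  rw [← hb] at e2 e3
  have hyζ : d.ζ * d.y = d'.ζ * d'.y :=
    mul_left_cancel₀ hd.b_pos.ne' (by linarith)
  have hy : d.y = d'.y := by
    refine (sq_eq_sq₀ hd.y_pos.le hd'.y_pos.le).1 ?_
    rw [hyζ] at e2
    linarith
  rw [← hy] at hyζ
  exact ⟨hb, mul_right_cancel₀ hd.y_pos.ne' hyζ⟩

theorem eq_of_trd_map (hd : d.IsGood) (hd' : d'.IsGood) {g : ℝ × ℝ → ℝ × ℝ}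
    (hg : ∀ u v, sqd (g u) (g v) = sqd u v)
    (hm : ∀ u ∈ ({v₁, d.v₄, d.r, d.o} : Set (ℝ × ℝ)),
      g u ∈ ({v₁, d'.v₄, d'.r, d'.o} : Set (ℝ × ℝ))) :
    d.H = d'.H ∧ d.ξ = d'.ξ := by
  obtain ⟨h1, h2, h3⟩ := hd.spike'.map_eq hd'.spike' hg hm
  have e1 := hg v₁ d.v₄
  have e2 := hg d.v₄ d.r
  have e3 := hg v₁ d.r
  rw [h1, h2] at e1
  rw [h2, h3] at e2
  rw [h1, h3] at e3
  simp only [sqd, v₁, v₄, r] at e1 e2 e3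
  have hq : d.q = d'.q := by
    refine (sq_eq_sq₀ hd.q_pos.le hd'.q_pos.le).1 ?_
    linarith
  rw [← hq] at e3
  have hξH : d.ξ * d.H = d'.ξ * d'.H :=
    mul_right_cancel₀ hd.q_pos.ne' (by linarith)
  have hH : d.H = d'.H := by
    refine (sq_eq_sq₀ hd.H_pos.le hd'.H_pos.le).1 ?_
    rw [hξH] at e1
    linarith
  rw [← hH] at hξH
  exact ⟨hH, mul_right_cancel₀ hd.H_pos.ne' hξH⟩

/-- A first cell congruent to a third one must have its base on the left leg of the other.
`IsFamily.b_lt` rules out the resulting equation. -/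
theorem eq_of_fst_map_trd (hd : d.IsGood) (hd' : d'.IsGood) {g : ℝ × ℝ → ℝ × ℝ}
    (hg : ∀ u v, sqd (g u) (g v) = sqd u v)
    (hm : ∀ u ∈ ({v₁, d.v₂, d.p, d.o} : Set (ℝ × ℝ)),
      g u ∈ ({v₁, d'.v₄, d'.r, d'.o} : Set (ℝ × ℝ))) :
    d.b = d'.H * √(2 + d.ζ ^ 2) := by
  obtain ⟨h1, h2, h3⟩ := hd.spike.map_eq hd'.spike' hg hm
  have e1 := hg v₁ d.v₂
  have e2 := hg d.v₂ d.p
  have e3 := hg v₁ d.p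
  rw [h1, h2] at e1
  rw [h2, h3] at e2
  rw [h1, h3] at e3
  simp only [sqd, v₁, v₂, p, v₄, r] at e1 e2 e3
  have hl : 0 < √(2 + d.ζ ^ 2) := by positivity
  have hm' : 0 < √(2 + d'.ξ ^ 2) := by positivity
  have hl2 : √(2 + d.ζ ^ 2) ^ 2 = 2 + d.ζ ^ 2 := Real.sq_sqrt (by positivity)
  have hm2 : √(2 + d'.ξ ^ 2) ^ 2 = 2 + d'.ξ ^ 2 := Real.sq_sqrt (by positivity)
  have hH := hd'.H_pos
  have hy := hd.y_pos
  have hb : d.b = d'.H * √(2 + d'.ξ ^ 2) := by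
    refine (sq_eq_sq₀ hd.b_pos.le (by positivity)).1 ?_
    rw [mul_pow, hm2]; linarith
  have hq : d'.q = d.y * √(2 + d.ζ ^ 2) := by
    refine (sq_eq_sq₀ hd'.q_pos.le (by positivity)).1 ?_
    rw [mul_pow, hl2]; linarith
  have hin : d.b * (d.ζ * d.y) = d'.ξ * d'.H * d'.q := by linarith
  rw [hb, hq] at hin
  -- Equality of the cosines of the angles at `v₂` and `v₄`.
  have hk : √(2 + d'.ξ ^ 2) * d.ζ = d'.ξ * √(2 + d.ζ ^ 2) :=
    mul_left_cancel₀ (mul_pos hH hy).ne' (by linarith)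
  have hsq : d.ζ ^ 2 = d'.ξ ^ 2 := by
    have := congrArg (· ^ 2) hk
    simp only [mul_pow, hl2, hm2] at this
    linarith
  rw [hb, hsq]

/-- The two outer sides and the diagonal `pr` determine the slope and `H - y`. A congruence that
swaps the outer sides would turn `hlt` and `hlt'` into opposite strict inequalities. -/
theorem eq_of_snd_map (hd : d.IsGood) (hd' : d'.IsGood)
    (hlt : d.b + d.ζ * d.H - d.ξ * d.H - d.q < (d.H - d.y) * √(2 + d.ζ ^ 2))
    (hlt' : d'.b + d'.ζ * d'.H - d'.ξ * d'.H - d'.q < (d'.H - d'.y) * √(2 + d'.ζ ^ 2))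
    {g : ℝ × ℝ → ℝ × ℝ} (hg : ∀ u v, sqd (g u) (g v) = sqd u v)
    (hm : ∀ u ∈ ({d.p, d.v₃, d.r, d.o} : Set (ℝ × ℝ)),
      g u ∈ ({d'.p, d'.v₃, d'.r, d'.o} : Set (ℝ × ℝ))) :
    d.ζ = d'.ζ ∧ d.H - d.y = d'.H - d'.y := by
  obtain ⟨h1, h2⟩ := hd.kite.map_eq hd'.kite hg hm
  have side : ∀ d : Dissection, sqd d.p d.v₃ = (d.H - d.y) ^ 2 * (2 + d.ζ ^ 2) := fun d => by
    simp only [sqd, p, v₃]; ring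
  have side' : ∀ d : Dissection, sqd d.r d.v₃ = (d.b + d.ζ * d.H - d.ξ * d.H - d.q) ^ 2 := fun d => by
    simp only [sqd, r, v₃]; ring
  have diag : ∀ d : Dissection, sqd d.p d.r = sqd d.p d.v₃ + sqd d.r d.v₃
      - 2 * (d.ζ * (d.H - d.y) * (d.b + d.ζ * d.H - d.ξ * d.H - d.q)) := fun d => by
    simp only [sqd, p, r, v₃]; ring
  have e1 := hg d.p d.v₃
  have e2 := hg d.r d.v₃
  have e3 := hg d.p d.r
  rw [h1] at e1 e2
  have hw : 0 < d.b + d.ζ * d.H - d.ξ * d.H - d.q := by linarith [hd.q_lt]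
  have hw' : 0 < d'.b + d'.ζ * d'.H - d'.ξ * d'.H - d'.q := by linarith [hd'.q_lt]
  have hy : 0 < d.H - d.y := by linarith [hd.y_lt]
  have hy' : 0 < d'.H - d'.y := by linarith [hd'.y_lt]
  rcases h2 with ⟨hp, hr⟩ | ⟨hp, hr⟩
  · rw [hp] at e1
    rw [hr] at e2
    rw [hp, hr, diag, diag, e1, e2] at e3
    rw [side, side] at e1
    rw [side', side'] at e2
    have ew := (sq_eq_sq₀ hw'.le hw.le).1 e2
    rw [ew] at e3
    have hζy : d.ζ * (d.H - d.y) = d'.ζ * (d'.H - d'.y) :=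
      mul_right_cancel₀ hw.ne' (by linarith)
    have hyy : d.H - d.y = d'.H - d'.y := by
      refine (sq_eq_sq₀ hy.le hy'.le).1 ?_
      have := congrArg (· ^ 2) hζy
      simp only [mul_pow] at this
      linarith
    rw [← hyy] at hζy
    exact ⟨mul_right_cancel₀ hy.ne' hζy, hyy⟩
  · exfalso
    rw [hp, side, side'] at e1
    rw [hr, side, side'] at e2
    have hs : √(2 + d.ζ ^ 2) ^ 2 = 2 + d.ζ ^ 2 := Real.sq_sqrt (by positivity)
    have hs' : √(2 + d'.ζ ^ 2) ^ 2 = 2 + d'.ζ ^ 2 := Real.sq_sqrt (by positivity)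
    rw [← hs, ← mul_pow] at e1
    rw [← hs', ← mul_pow] at e2
    have f1 := (sq_eq_sq₀ hw'.le (by positivity)).1 e1
    have f2 := (sq_eq_sq₀ (by positivity) hw.le).1 e2
    linarith

/-! ### The cells dissect the trapezoid. -/

/-- The three cells of the dissection. -/
noncomputable def cell (d : Dissection) : Fin 3 → Set (ℝ × ℝ)
  | 0 => hull v₁ d.v₂ d.p d.o
  | 1 => hull d.p d.v₃ d.r d.o
  | 2 => hull v₁ d.o d.r d.v₄

def trapezoid (d : Dissection) : Set (ℝ × ℝ) :=
  {w | 0 ≤ w.2 ∧ w.2 ≤ d.H ∧ d.ξ * w.2 ≤ w.1 ∧ w.1 ≤ d.b + d.ζ * w.2}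

theorem IsGood.cell_subset (hd : d.IsGood) (i : Fin 3) : d.cell i ⊆ d.trapezoid := by
  have hconv : Convex ℝ d.trapezoid := by
    rintro x ⟨hx1, hx2, hx3, hx4⟩ y ⟨hy1, hy2, hy3, hy4⟩ α β hα hβ hαβ
    have := mul_le_mul_of_nonneg_left hx1 hα
    have := mul_le_mul_of_nonneg_left hx2 hα
    have := mul_le_mul_of_nonneg_left hx3 hα
    have := mul_le_mul_of_nonneg_left hx4 hα
    have := mul_le_mul_of_nonneg_left hy1 hβ
    have := mul_le_mul_of_nonneg_left hy2 hβ
    have := mul_le_mul_of_nonneg_left hy3 hβ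
    have := mul_le_mul_of_nonneg_left hy4 hβ
    obtain rfl : β = 1 - α := by linarith
    refine ⟨?_, ?_, ?_, ?_⟩ <;> simp <;> linarith
  have hH := hd.H_pos
  have hb := hd.b_pos
  have hq := hd.q_pos
  have hq' := hd.q_lt
  have hy := hd.y_pos
  have hy' := hd.y_lt
  -- The width is affine in the height and positive at both bases.
  have hwid : ∀ t, 0 ≤ t → t ≤ d.H → d.ξ * t ≤ d.b + d.ζ * t := by
    intro t h0 h1
    have h2 : 0 ≤ (d.H - t) * d.b + t * (d.b + d.ζ * d.H - d.ξ * d.H) :=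
      add_nonneg (mul_nonneg (by linarith) hb.le) (mul_nonneg h0 (by linarith))
    have h3 : 0 ≤ d.H * (d.b + d.ζ * t - d.ξ * t) := by linarith
    have := nonneg_of_mul_nonneg_right h3 hH
    linarith
  have m1 : v₁ ∈ d.trapezoid := by
    refine ⟨?_, ?_, ?_, ?_⟩ <;> simp [v₁] <;> linarith
  have m2 : d.v₂ ∈ d.trapezoid := by
    refine ⟨?_, ?_, ?_, ?_⟩ <;> simp [v₂] <;> linarith
  have m3 : d.v₃ ∈ d.trapezoid := by
    refine ⟨?_, ?_, ?_, ?_⟩ <;> simp [v₃] <;> linarith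
  have m4 : d.v₄ ∈ d.trapezoid := by
    refine ⟨?_, ?_, ?_, ?_⟩ <;> simp [v₄] <;> linarith
  have mp : d.p ∈ d.trapezoid :=
    ⟨hy.le, hy'.le, hwid _ hy.le hy'.le, le_refl _⟩
  have mr : d.r ∈ d.trapezoid := by
    refine ⟨?_, ?_, ?_, ?_⟩ <;> simp [r] <;> linarith
  have mo : d.o ∈ d.trapezoid := by
    have t1 := hd.fst.dab
    have t2 := hd.fst.bcd
    have t3 := hd.trd.bcd
    have t4 := hd.trd.dab
    simp only [turn, v₁, v₂, v₄, p, r, o] at t1 t2 t3 t4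
    refine ⟨?_, ?_, ?_, ?_⟩ <;> simp only [o]
    · exact (pos_of_mul_pos_right (show 0 < d.b * d.y₀ by linarith) hb.le).le
    · have := pos_of_mul_pos_right (show 0 < d.q * (d.H - d.y₀) by linarith) hq.le
      linarith
    · have := pos_of_mul_pos_right (show 0 < d.H * (d.x₀ - d.ξ * d.y₀) by linarith) hH.le
      linarith
    · have := pos_of_mul_pos_right (show 0 < d.y * (d.b + d.ζ * d.y₀ - d.x₀) by linarith) hy.le
      linarith
  match i with
  | 0 =>
    refine convexHull_min ?_ hconv
    rintro x (rfl | rfl | rfl | rfl) <;> assumption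
  | 1 =>
    refine convexHull_min ?_ hconv
    rintro x (rfl | rfl | rfl | rfl) <;> assumption
  | 2 =>
    refine convexHull_min ?_ hconv
    rintro x (rfl | rfl | rfl | rfl) <;> assumption

/-- The three cuts from `o` divide the trapezoid into sectors. As `o` is a positive combination of
`v₁`, `p`, `r`, a combination of the three `turn`s at `o` with positive weights vanishes (`id`), so
they cannot all have the same strict sign. -/
theorem IsGood.trapezoid_subset (hd : d.IsGood) {w : ℝ × ℝ} (hw : w ∈ d.trapezoid) :
    ∃ i, w ∈ d.cell i := by
  obtain ⟨w1, w2, w3, w4⟩ := hw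
  have hA : turn v₁ d.o w = - turn d.o v₁ w := by unfold turn; ring
  have hB : turn d.p d.o w = - turn d.o d.p w := by unfold turn; ring
  have hC : turn d.r d.o w = - turn d.o d.r w := by unfold turn; ring
  have id : turn d.r d.o d.p * turn d.o v₁ w + turn v₁ d.o d.r * turn d.o d.p w
      + turn d.p d.o v₁ * turn d.o d.r w = 0 := by unfold turn; ring
  have t1 := hd.snd.cda
  have t2 := hd.trd.abc
  have t3 := hd.fst.cda
  have c0 : 0 ≤ turn d.o v₁ w → turn d.o d.p w ≤ 0 → ∃ i, w ∈ d.cell i := fun h1 h2 => by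
    refine ⟨0, (mem_hull_iff hd.fst w).2 ⟨?_, ?_, by linarith, h1⟩⟩
    · have := mul_nonneg hd.b_pos.le w1
      simp only [turn, v₁, v₂]; linarith
    · have := mul_nonneg hd.y_pos.le (sub_nonneg.2 w4)
      simp only [turn, v₂, p]; linarith
  have c1 : 0 ≤ turn d.o d.p w → turn d.o d.r w ≤ 0 → ∃ i, w ∈ d.cell i := fun h1 h2 => by
    refine ⟨1, (mem_hull_iff hd.snd w).2 ⟨?_, ?_, by linarith, h1⟩⟩
    · have := mul_nonneg (sub_nonneg.2 hd.y_lt.le) (sub_nonneg.2 w4)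
      simp only [turn, v₃, p]; linarith
    · have := mul_nonneg (sub_nonneg.2 hd.q_lt.le) (sub_nonneg.2 w2)
      simp only [turn, v₃, r]; linarith
  have c2 : 0 ≤ turn d.o d.r w → turn d.o v₁ w ≤ 0 → ∃ i, w ∈ d.cell i := fun h1 h2 => by
    refine ⟨2, (mem_hull_iff hd.trd w).2 ⟨by linarith, h1, ?_, ?_⟩⟩
    · have := mul_nonneg hd.q_pos.le (sub_nonneg.2 w2)
      simp only [turn, v₄, r]; linarith
    · have := mul_nonneg hd.H_pos.le (sub_nonneg.2 w3)
      simp only [turn, v₄, v₁]; linarith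
  rcases le_or_gt 0 (turn d.o v₁ w) with hA | hA
  · rcases le_or_gt (turn d.o d.p w) 0 with hB | hB
    · exact c0 hA hB
    · rcases le_or_gt (turn d.o d.r w) 0 with hC | hC
      · exact c1 hB.le hC
      · exfalso
        have := mul_nonneg t1.le hA
        have := mul_pos t2 hB
        have := mul_pos t3 hC
        linarith
  · rcases le_or_gt 0 (turn d.o d.r w) with hC | hC
    · exact c2 hC hA.le
    · rcases le_or_gt 0 (turn d.o d.p w) with hB | hB
      · exact c1 hB hC.le
      · exfalso
        have := mul_neg_of_pos_of_neg t1 hA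
        have := mul_neg_of_pos_of_neg t2 hB
        have := mul_neg_of_pos_of_neg t3 hC
        linarith

theorem IsGood.disjoint_cell (hd : d.IsGood) {i j : Fin 3} (hij : i ≠ j) :
    Disjoint (interior (d.cell i)) (interior (d.cell j)) := by
  have key : ∀ {S T : Set (ℝ × ℝ)} {a b c : ℝ × ℝ}, 0 < turn a b c → (∀ w ∈ S, 0 ≤ turn a b w) →
      (∀ w ∈ T, 0 ≤ turn b a w) → Disjoint (interior S) (interior T) := by
    intro S T a b c hc hS hT
    refine disjoint_interior_of_separated (b.2 - a.2) (-(b.1 - a.1))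
      ((b.2 - a.2) * a.1 - (b.1 - a.1) * a.2) ?_ ?_ ?_
    · by_contra h
      have h1 : b.2 - a.2 = 0 := by nlinarith [sq_nonneg (b.2 - a.2), sq_nonneg (b.1 - a.1)]
      have h2 : b.1 - a.1 = 0 := by nlinarith [sq_nonneg (b.2 - a.2), sq_nonneg (b.1 - a.1)]
      rw [turn, h1, h2] at hc
      linarith
    · intro w hw
      have := hS w hw
      unfold turn at this
      linarith
    · intro w hw
      have := hT w hw
      unfold turn at this
      linarith
  have h01 : Disjoint (interior (d.cell 0)) (interior (d.cell 1)) :=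
    key hd.fst.cda (fun w hw => ((mem_hull_iff hd.fst w).1 hw).2.2.1)
      (fun w hw => ((mem_hull_iff hd.snd w).1 hw).2.2.2)
  have h02 : Disjoint (interior (d.cell 0)) (interior (d.cell 2)) :=
    key hd.fst.dab (fun w hw => ((mem_hull_iff hd.fst w).1 hw).2.2.2)
      (fun w hw => ((mem_hull_iff hd.trd w).1 hw).1)
  have h12 : Disjoint (interior (d.cell 1)) (interior (d.cell 2)) :=
    key hd.snd.cda (fun w hw => ((mem_hull_iff hd.snd w).1 hw).2.2.1)
      (fun w hw => ((mem_hull_iff hd.trd w).1 hw).2.1)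
  match i, j with
  | 0, 0 => exact absurd rfl hij
  | 0, 1 => exact h01
  | 0, 2 => exact h02
  | 1, 0 => exact h01.symm
  | 1, 1 => exact absurd rfl hij
  | 1, 2 => exact h12
  | 2, 0 => exact h02.symm
  | 2, 1 => exact h12.symm
  | 2, 2 => exact absurd rfl hij

end Dissection

end PlaneTiling

/-! ### Filling half-strips and stacking them. -/

namespace PlaneTiling

open Real Set MeasureTheory

theorem sqrt_sqd_of_sq {u v : ℝ × ℝ} {x : ℝ} (hx : 0 ≤ x) (h : sqd u v = x ^ 2) :
    √(sqd u v) = x := by rw [h, Real.sqrt_sq hx]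

namespace Dissection

variable {d : Dissection}

/-- Twice the area of the trapezoid. It yields the area of the second cell from the other two, and
the midline length `6 / H`. -/
theorem two_mul_b (d : Dissection) (hH : d.H ≠ 0) : d.H * (2 * d.b + (d.ζ - d.ξ) * d.H) = 12 := by
  unfold b bottom
  field_simp
  ring

/-- Each placed cell of a balanced dissection is a convex quadrangle of the prescribed area and
perimeter. -/
theorem IsGood.exists_polygon (hd : d.IsGood) (hb : d.IsBalanced) (s : Bool) (t : ℝ × ℝ)
    (i : Fin 3) :
    ∃ q : Polygon Plane 4, IsConvexQuadrangle q ∧ pt '' (place s t '' d.cell i) = region q ∧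
      volume (pt '' (place s t '' d.cell i)) = ENNReal.ofReal (2 * √2) ∧
      perimeter q = 4 + 2 * √3 := by
  have key : ∀ a b c e : ℝ × ℝ, IsCCW a b c e → d.cell i = hull a b c e →
      turn a b c + turn c e a = 4 →
      √(sqd a b) + √(sqd b c) + √(sqd c e) + √(sqd e a) = 4 + 2 * √3 →
      ∃ q : Polygon Plane 4, IsConvexQuadrangle q ∧ pt '' (place s t '' d.cell i) = region q ∧
      volume (pt '' (place s t '' d.cell i)) = ENNReal.ofReal (2 * √2) ∧
      perimeter q = 4 + 2 * √3 := by
    intro a b c e h hc ht hp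
    have hr : pt '' (place s t '' d.cell i) =
        region (quad (place s t a) (place s t b) (place s t c) (place s t e)) := by
      rw [hc, image_place_hull, region_quad]
    refine ⟨_, isConvexQuadrangle_quad (h.place s t), hr, ?_, ?_⟩
    · rw [hr, volume_region_quad (h.place s t), turn_place, turn_place, ht]
      congr 1
      ring
    · rw [perimeter_quad, sqd_place, sqd_place, sqd_place, sqd_place, hp]
  have hζ : √(2 + d.ζ ^ 2) ^ 2 = 2 + d.ζ ^ 2 := Real.sq_sqrt (by positivity)
  have hξ : √(2 + d.ξ ^ 2) ^ 2 = 2 + d.ξ ^ 2 := Real.sq_sqrt (by positivity)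
  have l12 : √(sqd v₁ d.v₂) = d.b :=
    sqrt_sqd_of_sq hd.b_pos.le (by simp only [sqd, v₁, v₂]; ring)
  have l2p : √(sqd d.v₂ d.p) = d.y * √(2 + d.ζ ^ 2) :=
    sqrt_sqd_of_sq (mul_nonneg hd.y_pos.le (Real.sqrt_nonneg _))
      (by rw [mul_pow, hζ]; simp only [sqd, v₂, p]; ring)
  have lpo : √(sqd d.p d.o) = len (d.b + d.ζ * d.y - d.x₀) (d.y - d.y₀) := rfl
  have lo1 : √(sqd d.o v₁) = len d.x₀ d.y₀ := by simp [sqd, o, v₁, len]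
  have lp3 : √(sqd d.p d.v₃) = (d.H - d.y) * √(2 + d.ζ ^ 2) :=
    sqrt_sqd_of_sq (mul_nonneg (sub_nonneg.2 hd.y_lt.le) (Real.sqrt_nonneg _))
      (by rw [mul_pow, hζ]; simp only [sqd, v₃, p]; ring)
  have l3r : √(sqd d.v₃ d.r) = d.b + d.ζ * d.H - d.ξ * d.H - d.q :=
    sqrt_sqd_of_sq (sub_nonneg.2 hd.q_lt.le) (by simp only [sqd, v₃, r]; ring)
  have lro : √(sqd d.r d.o) = len (d.ξ * d.H + d.q - d.x₀) (d.H - d.y₀) := rfl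
  have lr4 : √(sqd d.r d.v₄) = d.q :=
    sqrt_sqd_of_sq hd.q_pos.le (by simp only [sqd, v₄, r]; ring)
  have l41 : √(sqd d.v₄ v₁) = d.H * √(2 + d.ξ ^ 2) :=
    sqrt_sqd_of_sq (mul_nonneg hd.H_pos.le (Real.sqrt_nonneg _))
      (by rw [mul_pow, hξ]; simp only [sqd, v₄, v₁]; ring)
  have a1 := hb.areaFst
  have a3 := hb.areaTrd
  have p1 := hb.perimFst
  have p2 := hb.perimSnd
  have p3 := hb.perimTrd
  have a2 := d.two_mul_b hd.H_pos.ne'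
  unfold PlaneTiling.areaFst at a1
  unfold PlaneTiling.areaTrd at a3
  unfold PlaneTiling.perimFst at p1
  unfold PlaneTiling.perimSnd at p2
  unfold PlaneTiling.perimTrd at p3
  rw [← show d.b = bottom d.H d.ξ d.ζ from rfl] at a1 p1 p2
  match i with
  | 0 =>
    refine key v₁ d.v₂ d.p d.o hd.fst rfl ?_ ?_
    · simp only [turn, v₁, v₂, p, o]; linarith
    · rw [l12, l2p, lpo, lo1]; linarith
  | 1 =>
    refine key d.p d.v₃ d.r d.o hd.snd rfl ?_ ?_
    · simp only [turn, p, v₃, r, o]; linarith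
    · rw [lp3, l3r, lro, sqd_comm d.o, lpo]; linarith
  | 2 =>
    refine key v₁ d.o d.r d.v₄ hd.trd rfl ?_ ?_
    · simp only [turn, v₁, o, r, v₄]; linarith
    · rw [sqd_comm v₁, lo1, sqd_comm d.o, lro, lr4, l41]; linarith

end Dissection

/-- The slopes of the legs of the trapezoids in a strip of height `H`. -/
noncomputable def slopes (d : ℝ → ℝ → Dissection) (H σ : ℝ) : ℕ → ℝ
  | 0 => σ
  | k + 1 => (d H (slopes d H σ k)).ζ

/-- The abscissae of the lower left corners of the trapezoids in a strip of height `H`. -/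
noncomputable def corners (d : ℝ → ℝ → Dissection) (H σ x : ℝ) : ℕ → ℝ
  | 0 => x
  | k + 1 => corners d H σ x k + (d H (slopes d H σ k)).b

section Strip

variable {d : ℝ → ℝ → Dissection} {H σ : ℝ}

theorem leg_mono (hH : ∀ ξ, (d H ξ).H = H) (hξ : ∀ ξ, (d H ξ).ξ = ξ)
    (hg : ∀ k, (d H (slopes d H σ k)).IsGood) (x : ℝ) {y : ℝ} (h0 : 0 ≤ y) (h1 : y ≤ H) :
    Monotone fun k => corners d H σ x k + slopes d H σ k * y := by
  refine monotone_nat_of_le_succ fun k => ?_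
  have hb := (hg k).b_pos
  have hq := (hg k).q_pos
  have hq' := (hg k).q_lt
  have hH0 := (hg k).H_pos
  rw [hH, hξ] at hq'
  rw [hH] at hH0
  have h2 : 0 ≤ (H - y) * (d H (slopes d H σ k)).b + y * ((d H (slopes d H σ k)).b
      + (d H (slopes d H σ k)).ζ * H - slopes d H σ k * H) :=
    add_nonneg (mul_nonneg (by linarith) hb.le) (mul_nonneg h0 (by linarith))
  have h3 : 0 ≤ H * ((d H (slopes d H σ k)).b + (d H (slopes d H σ k)).ζ * y
      - slopes d H σ k * y) := by linarith
  have := nonneg_of_mul_nonneg_right h3 hH0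
  simp only [corners, slopes]
  linarith

theorem exists_cell_of_mem_strip (hH : ∀ ξ, (d H ξ).H = H) (hξ : ∀ ξ, (d H ξ).ξ = ξ)
    (hg : ∀ k, (d H (slopes d H σ k)).IsGood) (hs : ∀ k, |slopes d H σ k| ≤ 1) {x u y : ℝ}
    (h0 : 0 ≤ y) (h1 : y ≤ H) (hu : x + σ * y ≤ u) :
    ∃ k i, (u - corners d H σ x k, y) ∈ (d H (slopes d H σ k)).cell i := by
  have hH0 : 0 < H := by have := (hg 0).H_pos; rwa [hH] at this
  -- All midlines have length `6 / H`, so the midpoints of the legs advance at constant speed; with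
  -- bounded slopes, the legs leave every bounded region.
  have hmid : ∀ k : ℕ, corners d H σ x k + slopes d H σ k * (H / 2) = x + σ * (H / 2) + 6 / H * k := by
    intro k
    induction k with
    | zero => simp [corners, slopes]
    | succ k ih =>
      have e := (d H (slopes d H σ k)).two_mul_b (by rw [hH]; exact hH0.ne')
      rw [hH, hξ] at e
      have e' : (d H (slopes d H σ k)).b + ((d H (slopes d H σ k)).ζ - slopes d H σ k) * (H / 2)
          = 6 / H := by
        rw [eq_div_iff hH0.ne']; linarith
      simp only [corners, slopes]
      push_cast
      linarith
  have hex : ∃ k : ℕ, u < corners d H σ x k + slopes d H σ k * y := by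
    obtain ⟨k, hk⟩ := exists_nat_gt ((u - x - σ * (H / 2) + H) / (6 / H))
    refine ⟨k, ?_⟩
    rw [div_lt_iff₀ (by positivity)] at hk
    have hm := hmid k
    have hsl : |slopes d H σ k * (y - H / 2)| ≤ 1 * H := by
      rw [abs_mul]
      exact mul_le_mul (hs k) (abs_le.2 ⟨by linarith, by linarith⟩) (abs_nonneg _) (by norm_num)
    have := (abs_le.1 hsl).1
    linarith
  classical
  obtain ⟨k, hk⟩ : ∃ k, Nat.find hex = k + 1 := by
    refine Nat.exists_eq_succ_of_ne_zero fun h => ?_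
    have := Nat.find_spec hex
    rw [h] at this
    simp only [corners, slopes] at this
    linarith
  have hk1 := Nat.find_spec hex
  have hk2 := Nat.find_min hex (m := k) (by omega)
  rw [hk] at hk1
  simp only [corners, slopes] at hk1
  rw [not_lt] at hk2
  have hmem : (u - corners d H σ x k, y) ∈ (d H (slopes d H σ k)).trapezoid := by
    refine ⟨h0, ?_, ?_, ?_⟩
    · rw [hH]; exact h1
    · rw [hξ]; simp only; linarith
    · simp only; linarith
  obtain ⟨i, hi⟩ := (hg k).trapezoid_subset hmem
  exact ⟨k, i, hi⟩

end Strip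

theorem exists_partial_sums (h : ℤ → ℝ) (h2 : ∀ j, 2 ≤ h j) :
    ∃ c : ℤ → ℝ, (∀ j, c (j + 1) = c j + h j) ∧ (∀ i j, i < j → c (i + 1) ≤ c j) ∧
      ∀ y, ∃ j, c j ≤ y ∧ y ≤ c (j + 1) := by
  obtain ⟨c, hc⟩ : ∃ c : ℤ → ℝ, ∀ j, c (j + 1) = c j + h j := by
    refine ⟨fun j => ∑ i ∈ Finset.Ico 0 j, h i - ∑ i ∈ Finset.Ico j 0, h i, fun j => ?_⟩
    rcases le_or_gt 0 j with hj | hj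
    · have e1 : Finset.Ico 0 (j + 1) = insert j (Finset.Ico 0 j) := by
        ext i; simp only [Finset.mem_Ico, Finset.mem_insert]; omega
      have e2 : Finset.Ico (j + 1) 0 = ∅ := by
        ext i; simp only [Finset.mem_Ico, Finset.notMem_empty, iff_false]; omega
      have e3 : Finset.Ico j 0 = ∅ := by
        ext i; simp only [Finset.mem_Ico, Finset.notMem_empty, iff_false]; omega
      simp only [e1, e2, e3]
      rw [Finset.sum_insert (by simp)]
      simp
      ring
    · have e1 : Finset.Ico j 0 = insert j (Finset.Ico (j + 1) 0) := by
        ext i; simp only [Finset.mem_Ico, Finset.mem_insert]; omega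
      have e2 : Finset.Ico 0 (j + 1) = ∅ := by
        ext i; simp only [Finset.mem_Ico, Finset.notMem_empty, iff_false]; omega
      have e3 : Finset.Ico 0 j = ∅ := by
        ext i; simp only [Finset.mem_Ico, Finset.notMem_empty, iff_false]; omega
      simp only [e1, e2, e3]
      rw [Finset.sum_insert (by simp)]
      simp
  -- Growth by at least 2 per step makes the partial sums unbounded in both directions.
  have hmono : Monotone fun j : ℤ => c j - 2 * j := by
    refine monotone_int_of_le_succ fun j => ?_
    have := h2 j
    simp only [hc]
    push_cast
    linarith
  have hmono' : Monotone c := by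
    refine monotone_int_of_le_succ fun j => ?_
    have := h2 j
    rw [hc]
    linarith
  refine ⟨c, hc, fun i j hij => hmono' (by omega), fun y => ?_⟩
  have hlow : ∃ j, c j ≤ y := by
    refine ⟨min 0 ⌊(y - c 0) / 2⌋, ?_⟩
    have h1 := hmono (min_le_left 0 ⌊(y - c 0) / 2⌋)
    have h3 : ((min 0 ⌊(y - c 0) / 2⌋ : ℤ) : ℝ) ≤ (y - c 0) / 2 :=
      (Int.cast_le.2 (min_le_right _ _)).trans (Int.floor_le _)
    simp only [Int.cast_zero] at h1
    linarith
  have hbdd : ∃ b : ℤ, ∀ j, c j ≤ y → j ≤ b := by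
    refine ⟨max 0 (⌈(y - c 0) / 2⌉), fun j hj => ?_⟩
    by_contra hlt
    rw [not_le, max_lt_iff] at hlt
    have h1 := hmono hlt.1.le
    have h3 : (y - c 0) / 2 < j := lt_of_le_of_lt (Int.le_ceil _) (Int.cast_lt.2 hlt.2)
    simp only [Int.cast_zero] at h1
    linarith
  obtain ⟨j, hj, hmax⟩ := Int.exists_greatest_of_bdd hbdd hlow
  refine ⟨j, hj, ?_⟩
  by_contra hlt
  have := hmax (j + 1) (not_le.1 hlt).le
  omega

end PlaneTiling

/-! ### Incongruence and the tiling of the plane. -/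

namespace PlaneTiling

open Real Set MeasureTheory Dissection

section Family

variable {υ : ℝ} {d : ℝ → ℝ → Dissection}

/-- Congruent cells of the family have the same parameters. -/
theorem IsFamily.eq_of_congruent (hf : IsFamily υ d) {H ξ H' ξ' : ℝ} (h : InRange υ H ξ)
    (h' : InRange υ H' ξ') {s s' : Bool} {t t' : ℝ × ℝ} {i i' : Fin 3}
    (hc : SetCongruent (pt '' (place s t '' (d H ξ).cell i))
      (pt '' (place s' t' '' (d H' ξ').cell i'))) : H = H' ∧ ξ = ξ' ∧ i = i' := by
  have g := hf.isGood H ξ h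
  have g' := hf.isGood H' ξ' h'
  -- The third cell is listed counterclockwise as `v₁, o, r, v₄`, but as a spike in the mirrored
  -- order.
  have swap : ∀ a b c e : ℝ × ℝ, ({a, b, c, e} : Set (ℝ × ℝ)) = {a, e, c, b} := by
    intro a b c e
    ext x
    simp only [mem_insert_iff, mem_singleton_iff]
    tauto
  match i, i' with
  | 0, 0 =>
    obtain ⟨f, hf1, hf2⟩ := exists_vertex_map_place g.fst g'.fst hc
    obtain ⟨e1, e2⟩ := eq_of_fst_map g g' hf1 hf2
    obtain ⟨e3, e4⟩ := hf.eq_of_b_eq H ξ H' ξ' h h' e2 e1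
    exact ⟨e3, e4, rfl⟩
  | 0, 1 =>
    obtain ⟨f, hf1, hf2⟩ := exists_vertex_map_place g.fst g'.snd hc
    exact (not_spike_to_kite g.spike g'.kite hf1 hf2).elim
  | 0, 2 =>
    obtain ⟨f, hf1, hf2⟩ := exists_vertex_map_place g.fst g'.trd hc
    rw [swap v₁ (d H' ξ').o] at hf2
    have e := eq_of_fst_map_trd g g' hf1 hf2
    rw [hf.H_eq] at e
    exact absurd e (hf.b_lt H ξ H' ξ' h h').ne
  | 1, 0 =>
    obtain ⟨f, hf1, hf2⟩ := exists_vertex_map_place g'.fst g.snd hc.symm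
    exact (not_spike_to_kite g'.spike g.kite hf1 hf2).elim
  | 1, 1 =>
    obtain ⟨f, hf1, hf2⟩ := exists_vertex_map_place g.snd g'.snd hc
    have k := hf.side_lt H ξ h
    have k' := hf.side_lt H' ξ' h'
    obtain ⟨e1, e2⟩ := eq_of_snd_map g g' (by rwa [hf.H_eq, hf.ξ_eq])
      (by rwa [hf.H_eq, hf.ξ_eq]) hf1 hf2
    rw [hf.H_eq, hf.H_eq] at e2
    obtain ⟨e3, e4⟩ := hf.eq_of_y_eq H ξ H' ξ' h h' e1 e2
    exact ⟨e3, e4, rfl⟩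
  | 1, 2 =>
    obtain ⟨f, hf1, hf2⟩ := exists_vertex_map_place g'.trd g.snd hc.symm
    rw [swap v₁ (d H' ξ').o] at hf2
    exact (not_spike_to_kite g'.spike' g.kite hf1 hf2).elim
  | 2, 0 =>
    obtain ⟨f, hf1, hf2⟩ := exists_vertex_map_place g'.fst g.trd hc.symm
    rw [swap v₁ (d H ξ).o] at hf2
    have e := eq_of_fst_map_trd g' g hf1 hf2
    rw [hf.H_eq] at e
    exact absurd e (hf.b_lt H' ξ' H ξ h' h).ne
  | 2, 1 =>
    obtain ⟨f, hf1, hf2⟩ := exists_vertex_map_place g.trd g'.snd hc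
    rw [swap v₁ (d H ξ).o] at hf2
    exact (not_spike_to_kite g.spike' g'.kite hf1 hf2).elim
  | 2, 2 =>
    obtain ⟨f, hf1, hf2⟩ := exists_vertex_map_place g.trd g'.trd hc
    rw [swap v₁ (d H ξ).o, swap v₁ (d H' ξ').o] at hf2
    obtain ⟨e1, e2⟩ := eq_of_trd_map g g' hf1 hf2
    rw [hf.H_eq, hf.H_eq] at e1
    rw [hf.ξ_eq, hf.ξ_eq] at e2
    exact ⟨e1, e2, rfl⟩

theorem IsFamily.inRange_slopes (hf : IsFamily υ d) (hυ : 0 < υ) {H : ℝ} (h1 : 2 + 4 * υ ≤ H)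
    (h2 : H ≤ 2 + 5 * υ) (k : ℕ) : InRange υ H (slopes d H (-1 / 2 + υ) k) := by
  induction k with
  | zero =>
    refine ⟨h1, h2, ?_⟩
    simp only [slopes]
    rw [show -1 / 2 + υ + 1 / 2 = υ by ring, abs_of_pos hυ]
  | succ k ih => exact ⟨h1, h2, (hf.abs_ζ_lt _ _ ih).le⟩

/-- The initial slope is at distance exactly `υ` from -1/2 and all later ones are strictly closer,
so it never recurs; a repetition further on would propagate back to it by injectivity of `ξ ↦ ζ`. -/
theorem IsFamily.slopes_injective (hf : IsFamily υ d) (hυ : 0 < υ) {H : ℝ} (h1 : 2 + 4 * υ ≤ H)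
    (h2 : H ≤ 2 + 5 * υ) : Function.Injective (slopes d H (-1 / 2 + υ)) := by
  have hr := hf.inRange_slopes hυ h1 h2
  have hne : ∀ k, slopes d H (-1 / 2 + υ) 0 ≠ slopes d H (-1 / 2 + υ) (k + 1) := by
    intro k hk
    have := hf.abs_ζ_lt _ _ (hr k)
    change |slopes d H (-1 / 2 + υ) (k + 1) + 1 / 2| < υ at this
    rw [← hk] at this
    simp only [slopes] at this
    rw [show -1 / 2 + υ + 1 / 2 = υ by ring, abs_of_pos hυ] at this
    exact lt_irrefl _ this
  intro k
  induction k with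
  | zero =>
    intro l hl
    cases l with
    | zero => rfl
    | succ l => exact absurd hl (hne l)
  | succ k ih =>
    intro l hl
    cases l with
    | zero => exact absurd hl.symm (hne k)
    | succ l => rw [ih (hf.eq_of_ζ_eq _ _ _ (hr k) (hr l) hl)]

end Family

theorem exists_tiling :
    ∃ (𝒯 : Set (Set Plane)) (A p : ℝ), 0 < A ∧ 0 < p ∧ IsTiling 𝒯 Set.univ ∧
      (∀ T ∈ 𝒯, ∃ q : Polygon Plane 4, IsConvexQuadrangle q ∧ T = region q ∧
        volume T = ENNReal.ofReal A ∧ perimeter q = p) ∧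
      𝒯.Pairwise (fun S T => ¬ SetCongruent S T) := by
  obtain ⟨υ, hυ, hυ1, d, hf⟩ := exists_isFamily
  set σ := -1 / 2 + υ with hσ
  -- Pairwise distinct admissible heights for the half-strips on both sides.
  let H : Bool → ℤ → ℝ := fun s j => 2 + 4 * υ + υ / (Encodable.encode (s, j) + 1)
  have hH1 : ∀ s j, 2 + 4 * υ ≤ H s j := fun s j => by
    have : 0 ≤ υ / (Encodable.encode (s, j) + 1) := by positivity
    simp only [H]; linarith
  have hH2 : ∀ s j, H s j ≤ 2 + 5 * υ := fun s j => by
    have : υ / (Encodable.encode (s, j) + 1) ≤ υ := div_le_self hυ.le (by simp)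
    simp only [H]; linarith
  have hHinj : ∀ s j s' j', H s j = H s' j' → s = s' ∧ j = j' := by
    intro s j s' j' h
    have h1 : υ / ((Encodable.encode (s, j) : ℝ) + 1) = υ / ((Encodable.encode (s', j') : ℝ) + 1) :=
      add_left_cancel h
    rw [div_eq_div_iff (by positivity) (by positivity)] at h1
    have h2 : (Encodable.encode (s, j) : ℝ) = Encodable.encode (s', j') := by
      linarith [mul_left_cancel₀ hυ.ne' h1]
    have h3 := Encodable.encode_injective (Nat.cast_injective h2)
    simpa using h3
  choose c hc hcmono hccov using fun s => exists_partial_sums (H s)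
    (fun j => by linarith [hH1 s j])
  let S : Bool → ℤ → ℕ → ℝ := fun s j => slopes d (H s j) σ
  -- Starting at abscissa `σ * c s j` puts the first legs of all half-strips on one line through the
  -- origin, which the half-turn preserves while exchanging its sides.
  let C : Bool → ℤ → ℕ → ℝ := fun s j => corners d (H s j) σ (σ * c s j)
  have hS : ∀ s j k, InRange υ (H s j) (S s j k) := fun s j k =>
    hf.inRange_slopes hυ (hH1 s j) (hH2 s j) k
  have hg : ∀ s j k, (d (H s j) (S s j k)).IsGood := fun s j k => hf.isGood _ _ (hS s j k)
  let loc : Bool × ℤ × ℕ × Fin 3 → Set (ℝ × ℝ) := fun x =>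
    place x.1 (C x.1 x.2.1 x.2.2.1, c x.1 x.2.1) ''
      (d (H x.1 x.2.1) (S x.1 x.2.1 x.2.2.1)).cell x.2.2.2
  have hcong : ∀ x x', SetCongruent (pt '' loc x) (pt '' loc x') → x = x' := by
    rintro ⟨s, j, k, i⟩ ⟨s', j', k', i'⟩ h
    obtain ⟨e1, e2, rfl⟩ := hf.eq_of_congruent (hS s j k) (hS s' j' k') h
    obtain ⟨rfl, rfl⟩ := hHinj _ _ _ _ e1
    rw [hf.slopes_injective hυ (hH1 s j) (hH2 s j) e2]
  have hpoly : ∀ x, ∃ q : Polygon Plane 4, IsConvexQuadrangle q ∧ pt '' loc x = region q ∧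
      volume (pt '' loc x) = ENNReal.ofReal (2 * √2) ∧ perimeter q = 4 + 2 * √3 :=
    fun x => (hg _ _ _).exists_polygon (hf.isBalanced _ _ (hS _ _ _)) _ _ _
  have hbounds : ∀ s j k i, ∀ w ∈ loc (s, j, k, i), ∃ u : ℝ × ℝ,
      w = (if s then u else -u) ∧ c s j ≤ u.2 ∧ u.2 ≤ c s (j + 1) ∧
      C s j k + S s j k * (u.2 - c s j) ≤ u.1 ∧
      u.1 ≤ C s j (k + 1) + S s j (k + 1) * (u.2 - c s j) := by
    rintro s j k i w ⟨u, hu, rfl⟩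
    obtain ⟨h1, h2, h3, h4⟩ := (hg s j k).cell_subset i hu
    rw [hf.H_eq] at h2
    rw [hf.ξ_eq] at h3
    refine ⟨(C s j k, c s j) + u, rfl, ?_, ?_, ?_, ?_⟩
    · simpa using h1
    · rw [hc]; simpa using h2
    · simpa using h3
    · simp only [Prod.fst_add, Prod.snd_add, add_sub_cancel_left]
      change C s j k + u.1 ≤ C s j k + (d (H s j) (S s j k)).b
        + (d (H s j) (S s j k)).ζ * u.2
      linarith
  have hlegs : ∀ s j y, c s j ≤ y → y ≤ c s (j + 1) →
      Monotone fun k => C s j k + S s j k * (y - c s j) := fun s j y h1 h2 =>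
    leg_mono (fun ξ => hf.H_eq _ ξ) (fun ξ => hf.ξ_eq _ ξ) (hg s j) _ (by linarith)
      (by rw [hc] at h2; linarith)
  have hhalf : ∀ s j k i, ∀ w ∈ loc (s, j, k, i), ∃ u : ℝ × ℝ,
      w = (if s then u else -u) ∧ σ * u.2 ≤ u.1 := by
    intro s j k i w hw
    obtain ⟨u, hu, h1, h2, h3, -⟩ := hbounds s j k i w hw
    refine ⟨u, hu, ?_⟩
    have := hlegs s j u.2 h1 h2 (Nat.zero_le k)
    simp only [C, S, corners, slopes] at this h3
    linarith
  have hstrip : ∀ s j j' k k' i i', j < j' →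
      Disjoint (interior (loc (s, j, k, i))) (interior (loc (s, j', k', i'))) := by
    intro s j j' k k' i i' hj
    have hm := hcmono s j j' hj
    cases s
    · refine (disjoint_interior_of_separated 0 1 (-c false j') (by norm_num) ?_ ?_).symm
      · intro w hw
        obtain ⟨u, rfl, h1, -⟩ := hbounds _ _ _ _ w hw
        simpa using h1
      · intro w hw
        obtain ⟨u, rfl, -, h1, -⟩ := hbounds _ _ _ _ w hw
        simpa using h1.trans hm
    · refine disjoint_interior_of_separated 0 1 (c true j') (by norm_num) ?_ ?_
      · intro w hw
        obtain ⟨u, rfl, -, h1, -⟩ := hbounds _ _ _ _ w hw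
        simpa using h1.trans hm
      · intro w hw
        obtain ⟨u, rfl, h1, -⟩ := hbounds _ _ _ _ w hw
        simpa using h1
  have htrap : ∀ s j k k' i i', k < k' →
      Disjoint (interior (loc (s, j, k, i))) (interior (loc (s, j, k', i'))) := by
    intro s j k k' i i' hk
    have hm : ∀ u : ℝ × ℝ, c s j ≤ u.2 → u.2 ≤ c s (j + 1) →
        C s j k' + S s j k' * (u.2 - c s j) ≤ u.1 →
        C s j (k + 1) + S s j (k + 1) * (u.2 - c s j) ≤ u.1 := fun u h1 h2 h3 =>
      (hlegs s j u.2 h1 h2 (Nat.succ_le_of_lt hk)).trans h3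
    have hpos : 0 < (1 : ℝ) ^ 2 + (-S s j (k + 1)) ^ 2 := by positivity
    cases s
    · refine (disjoint_interior_of_separated 1 (-S false j (k + 1))
        (-(C false j (k + 1) - S false j (k + 1) * c false j)) hpos ?_ ?_).symm
      · intro w hw
        obtain ⟨u, rfl, h1, h2, h3, -⟩ := hbounds _ _ _ _ w hw
        have := hm _ h1 h2 h3
        simp
        linarith
      · intro w hw
        obtain ⟨u, rfl, -, -, -, h4⟩ := hbounds _ _ _ _ w hw
        simp
        linarith
    · refine disjoint_interior_of_separated 1 (-S true j (k + 1))
        (C true j (k + 1) - S true j (k + 1) * c true j) hpos ?_ ?_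
      · intro w hw
        obtain ⟨u, rfl, -, -, -, h4⟩ := hbounds _ _ _ _ w hw
        simp
        linarith
      · intro w hw
        obtain ⟨u, rfl, h1, h2, h3, -⟩ := hbounds _ _ _ _ w hw
        have := hm _ h1 h2 h3
        simp
        linarith
  have hcell : ∀ s j k i i', i ≠ i' →
      Disjoint (interior (loc (s, j, k, i))) (interior (loc (s, j, k, i'))) := by
    intro s j k i i' hi
    have e : ∀ A : Set (ℝ × ℝ), interior (place s (C s j k, c s j) '' A) =
        place s (C s j k, c s j) '' interior A := by
      intro A
      cases s
      · exact (((Homeomorph.addLeft (C false j k, c false j)).trans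
          (Homeomorph.neg (ℝ × ℝ))).image_interior A).symm
      · exact ((Homeomorph.addLeft (C true j k, c true j)).image_interior A).symm
    simp only [loc, e]
    exact Set.disjoint_image_of_injective (place_injective _ _) ((hg s j k).disjoint_cell hi)
  have hsides : ∀ j j' k k' i i',
      Disjoint (interior (loc (true, j, k, i))) (interior (loc (false, j', k', i'))) := by
    intro j j' k k' i i'
    refine (disjoint_interior_of_separated 1 (-σ) 0 (by positivity) ?_ ?_).symm
    · intro w hw
      obtain ⟨u, rfl, h1⟩ := hhalf _ _ _ _ w hw
      simp
      linarith
    · intro w hw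
      obtain ⟨u, rfl, h1⟩ := hhalf _ _ _ _ w hw
      simp
      linarith
  have hdisj : ∀ x x', x ≠ x' → Disjoint (interior (loc x)) (interior (loc x')) := by
    rintro ⟨s, j, k, i⟩ ⟨s', j', k', i'⟩ hne
    by_cases hs : s = s'
    · subst hs
      rcases lt_trichotomy j j' with hj | rfl | hj
      · exact hstrip _ _ _ _ _ _ _ hj
      · rcases lt_trichotomy k k' with hk | rfl | hk
        · exact htrap _ _ _ _ _ _ hk
        · exact hcell _ _ _ _ _ (fun h => hne (by rw [h]))
        · exact (htrap _ _ _ _ _ _ hk).symm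
      · exact (hstrip _ _ _ _ _ _ _ hj).symm
    · cases s <;> cases s'
      · exact absurd rfl hs
      · exact (hsides _ _ _ _ _ _).symm
      · exact hsides _ _ _ _ _ _
      · exact absurd rfl hs
  have hcover : ∀ (s : Bool) (u : ℝ × ℝ), σ * u.2 ≤ u.1 → ∃ x, (if s then u else -u) ∈ loc x := by
    intro s u hu
    obtain ⟨j, hj1, hj2⟩ := hccov s u.2
    have hs : ∀ k, |slopes d (H s j) σ k| ≤ 1 := fun k => by
      have := abs_le.1 (hS s j k).ξ_abs
      exact abs_le.2 ⟨by linarith [this.1], by linarith [this.2]⟩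
    obtain ⟨k, i, hki⟩ := exists_cell_of_mem_strip (x := σ * c s j) (u := u.1) (y := u.2 - c s j)
      (fun ξ => hf.H_eq _ ξ) (fun ξ => hf.ξ_eq _ ξ) (hg s j) hs (by linarith)
      (by rw [hc] at hj2; linarith) (by linarith)
    refine ⟨(s, j, k, i), _, hki, ?_⟩
    have : ((C s j k, c s j) : ℝ × ℝ) + (u.1 - corners d (H s j) σ (σ * c s j) k, u.2 - c s j) = u := by
      ext <;> simp [C]
    simp only [place, this]
  refine ⟨range fun x => pt '' loc x, 2 * √2, 4 + 2 * √3, by positivity, by positivity,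
    ⟨countable_range _, ?_, ?_, ?_⟩, ?_, ?_⟩
  · rintro _ ⟨x, rfl⟩
    obtain ⟨q, -, hq, -⟩ := hpoly x
    simp only
    rw [hq]
    exact (finite_range q.vertices).isCompact_convexHull ℝ
  · rintro _ ⟨x, rfl⟩ _ ⟨x', rfl⟩ hne
    exact disjoint_interior_image_pt (hdisj x x' fun h => hne (by rw [h]))
  · refine eq_univ_of_forall fun z => ?_
    obtain ⟨u, rfl⟩ := pt.surjective z
    obtain ⟨x, hx⟩ : ∃ x, u ∈ loc x := by
      rcases le_total (σ * u.2) u.1 with h | h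
      · simpa using hcover true u h
      · simpa using hcover false (-u) (by simp; linarith)
    exact ⟨_, ⟨x, rfl⟩, mem_image_of_mem _ hx⟩
  · rintro _ ⟨x, rfl⟩
    exact hpoly x
  · rintro _ ⟨x, rfl⟩ _ ⟨x', rfl⟩ hne h
    exact hne (by rw [hcong x x' h])

end PlaneTiling

theorem theorem2 :
    ∃ (𝒯 : Set (Set PlaneTiling.Plane)) (A p : ℝ), 0 < A ∧ 0 < p ∧
      PlaneTiling.IsTiling 𝒯 Set.univ ∧
      (∀ T ∈ 𝒯, ∃ q : Polygon PlaneTiling.Plane 4,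
        PlaneTiling.IsConvexQuadrangle q ∧ T = PlaneTiling.region q ∧
        MeasureTheory.volume T = ENNReal.ofReal A ∧ PlaneTiling.perimeter q = p) ∧
      𝒯.Pairwise (fun S T => ¬ PlaneTiling.SetCongruent S T) :=
  PlaneTiling.exists_tiling
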